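/- **Theorem 4.2.2 (The Length Formula).** Realise Thompson's group $F$ as the group $\mathrm{PL}_2(\mathbb R)$ of all piecewise-linear, orientation-preserving homeomorphisms $f$ of $\mathbb R$ with finitely many breakpoints, each with dyadic rational coordinates, with all slopes powers of $2$, and whose leftmost and rightmost linear segments have the form $t\mapsto t-m$ and $t\mapsto t-n$ with $m,n\in\mathbb Z$; products are compositions, $(gf)(t)=g(f(t))$. Let $x_0(t)=t-1$, and let $x_1(t)=t$ for $t\le 0$, $x_1(t)=t/2$ for $0\le t\le 2$, $x_1(t)=t-1$ for $t\ge 2$. A *bounded binary forest* is a sequence $(T_i)_{i\in\mathbb Z}$ of finite binary trees, only finitely many of them nontrivial, with a pointer at $T_0$. It subdivides $\mathbb R$ into dyadic intervals: $T_i$ represents $[i,i+1]$, each caret cuts an interval in half, and the leaves represent the intervals of the subdivision. A *forest diagram* is a pair of bounded binary forests (bottom and top) with an order-preserving bijection of their leaves; it is a forest diagram *for* $f\in F$ if $f$ maps the interval of each bottom leaf linearly onto the interval of the corresponding top leaf. It is *reduced* if it has no opposing pair of carets, that is, no bottom caret with two leaves as children that correspond to the two leaves of a top caret. The *support* of a forest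 diagram is the minimum interval of columns (pairs of corresponding leaves) containing the two trees with pointers and all nontrivial trees. The *spaces* of a forest are the gaps between consecutive leaves; a space is *interior* if it lies between two leaves of the same tree, and *exterior* if it lies between two trees. Corresponding gaps of the two forests form one space of the diagram, and a space is in the support if the columns on both of its sides are. In each of the two forests label each space: $L$ if it is exterior and to the left of the pointer; $N$ if it lies immediately to the left of some caret (i.e. the leaf to its right is the leftmost leaf below some caret) and is not labeled $L$; $R$ if it is exterior, to the right of the pointer and not labeled $N$; $I$ if it is interior and not labeled $N$. The *weight* of a space with given top label (row) and bottom label (column) is $$\begin{array}{c|cccc} & L & N & R & I\\ \hline L & 2&1&1&1\\ N & 1&2&2&2\\ R & 1&2&2&0\\ I & 1&2&0&0\end{array}$$ Every $f\in F$ has exactly one reduced forest diagram $\mathfrak f$, and the word length of $f$ with respect to $\{x_0,x_1\}$, i.e. the least length of a word in $x_0^{\pm1},x_1^{\pm1}$ with product $f$, exists and equals $$\ell(f)=\ell_0(f)+\ell_1(f),$$ where $\ell_0(f)$ is the sum of the weights of all spaces in the support of $\mathfrak f$ and $\ell_1(f)$ is the total number of carets in the two forests of $\mathfrak f$. -/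

import Mathlib

noncomputable section

namespace Thompson

/-! ### Thompson's group, as the group of piecewise-linear maps of the line -/

/-- Dyadic rational numbers, as real numbers. -/
def IsDyadic (x : ℝ) : Prop := ∃ (a : ℤ) (n : ℕ), x = (a : ℝ) / 2 ^ n

/-- `f` is piecewise linear, with finitely many breakpoints (all of them in `S`), each of which has
dyadic rational coordinates; every linear segment has slope a power of `2`; the leftmost segment
has the form `t ↦ t - m` and the rightmost one the form `t ↦ t - n`, with `m` and `n` integers.
Increasing bijections of `ℝ` are the same as orientation-preserving self-homeomorphisms of `ℝ`. -/
def IsPL2 (f : ℝ ≃o ℝ) : Prop :=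
  (∃ S : Set ℝ, S.Finite ∧ (∀ p ∈ S, IsDyadic p ∧ IsDyadic (f p)) ∧
    ∀ a b : ℝ, a ≤ b → (∀ p ∈ S, p ∉ Set.Ioo a b) →
      ∃ k : ℤ, ∀ t ∈ Set.Icc a b, f t = f a + (2 : ℝ) ^ k * (t - a)) ∧
  (∃ (m : ℤ) (A : ℝ), ∀ t ≤ A, f t = t - m) ∧
  (∃ (n : ℤ) (B : ℝ), ∀ t ≥ B, f t = t - n)

theorem IsDyadic.intCast (m : ℤ) : IsDyadic (m : ℝ) := ⟨m, 0, by simp⟩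

theorem IsDyadic.add {x y : ℝ} (hx : IsDyadic x) (hy : IsDyadic y) : IsDyadic (x + y) := by
  obtain ⟨a, n, rfl⟩ := hx
  obtain ⟨b, m, rfl⟩ := hy
  refine ⟨a * 2 ^ m + b * 2 ^ n, n + m, ?_⟩
  push_cast
  rw [pow_add]
  field_simp

theorem IsDyadic.neg {x : ℝ} (hx : IsDyadic x) : IsDyadic (-x) := by
  obtain ⟨a, n, rfl⟩ := hx
  exact ⟨-a, n, by push_cast; ring⟩

theorem IsDyadic.zpow_mul {x : ℝ} (hx : IsDyadic x) (k : ℤ) : IsDyadic ((2 : ℝ) ^ k * x) := by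
  obtain ⟨a, n, rfl⟩ := hx
  obtain ⟨j, rfl | rfl⟩ := k.eq_nat_or_neg
  · exact ⟨a * 2 ^ j, n, by push_cast; rw [zpow_natCast]; ring⟩
  · refine ⟨a, n + j, ?_⟩
    rw [zpow_neg, zpow_natCast, pow_add]
    field_simp

theorem IsPL2.isDyadic_apply {f : ℝ ≃o ℝ} (hf : IsPL2 f) {x : ℝ} (hx : IsDyadic x) :
    IsDyadic (f x) := by
  obtain ⟨⟨S, hS, hd, ha⟩, ⟨m, A, hA⟩, -⟩ := hf
  have key : ∀ s, s ≤ x → IsDyadic s → IsDyadic (f s) → (∀ p ∈ S, p ∉ Set.Ioo s x) →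
      IsDyadic (f x) := by
    intro s hsx h1 h2 h3
    obtain ⟨k, hk⟩ := ha s x hsx h3
    rw [hk x ⟨hsx, le_rfl⟩]
    exact h2.add (((hx.add h1.neg).zpow_mul k))
  by_cases hne : (S ∩ Set.Iic x).Nonempty
  · obtain ⟨s, ⟨hsS, hsx⟩, hmax⟩ :=
      Set.exists_max_image (S ∩ Set.Iic x) id (hS.subset Set.inter_subset_left) hne
    refine key s hsx (hd s hsS).1 (hd s hsS).2 fun p hp hpI => ?_
    exact absurd (hmax p ⟨hp, hpI.2.le⟩) (not_le.mpr hpI.1)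
  · obtain ⟨a, hle⟩ : ∃ a : ℤ, (a : ℝ) ≤ min A x := ⟨⌊min A x⌋, Int.floor_le _⟩
    refine key a (hle.trans (min_le_right _ _)) (IsDyadic.intCast a) ?_ fun p hp hpI => ?_
    · rw [hA a (hle.trans (min_le_left _ _))]
      exact (IsDyadic.intCast a).add (IsDyadic.intCast m).neg
    · exact hne ⟨p, hp, hpI.2.le⟩

theorem IsPL2.one : IsPL2 1 :=
  ⟨⟨∅, Set.finite_empty, by simp, fun a b _ _ => ⟨0, fun t _ => by simp⟩⟩,
    ⟨0, 0, fun t _ => by simp⟩, ⟨0, 0, fun t _ => by simp⟩⟩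

theorem IsPL2.inv {f : ℝ ≃o ℝ} (hf : IsPL2 f) : IsPL2 f⁻¹ := by
  obtain ⟨⟨S, hS, hd, ha⟩, ⟨m, A, hA⟩, ⟨n, B, hB⟩⟩ := hf
  have hi : ∀ t, f⁻¹ t = f.symm t := fun _ => rfl
  refine ⟨⟨f '' S, hS.image f, ?_, ?_⟩, ⟨-m, A - m, fun t ht => ?_⟩, ⟨-n, B - n, fun t ht => ?_⟩⟩
  · rintro _ ⟨p, hp, rfl⟩
    rw [hi, f.symm_apply_apply]
    exact (hd p hp).symm
  · intro a b hab h
    obtain ⟨k, hk⟩ := ha (f.symm a) (f.symm b) (f.symm.monotone hab) fun p hp hpI =>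
      h (f p) ⟨p, hp, rfl⟩ ⟨(f.symm_apply_lt).mp hpI.1, (f.lt_symm_apply).mp hpI.2⟩
    refine ⟨-k, fun t ht => ?_⟩
    have := hk (f.symm t) ⟨f.symm.monotone ht.1, f.symm.monotone ht.2⟩
    rw [f.apply_symm_apply, f.apply_symm_apply] at this
    have hz : ((2 : ℝ) ^ k) ≠ 0 := by positivity
    rw [hi, hi, zpow_neg]
    field_simp
    linarith
  · rw [hi, f.symm_apply_eq, hA _ (by push_cast; linarith)]
    push_cast; ring
  · rw [hi, f.symm_apply_eq, hB _ (by push_cast; linarith)]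
    push_cast; ring

theorem IsPL2.mul {g f : ℝ ≃o ℝ} (hg : IsPL2 g) (hf : IsPL2 f) : IsPL2 (g * f) := by
  have hg' := hg
  have hf' := hf
  obtain ⟨⟨S, hS, hd, ha⟩, ⟨m, A, hA⟩, ⟨n, B, hB⟩⟩ := hf
  obtain ⟨⟨S', hS', hd', ha'⟩, ⟨m', A', hA'⟩, ⟨n', B', hB'⟩⟩ := hg
  refine ⟨⟨S ∪ (f ⁻¹' S' ∩ {p | IsDyadic p}), ?_, ?_, ?_⟩,
    ⟨m + m', min A (A' + m), fun t ht => ?_⟩, ⟨n + n', max B (B' + n), fun t ht => ?_⟩⟩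
  · exact hS.union ((hS'.preimage f.injective.injOn).subset Set.inter_subset_left)
  · rintro p (hp | ⟨hp, hp'⟩)
    · exact ⟨(hd p hp).1, hg'.isDyadic_apply (hd p hp).2⟩
    · exact ⟨hp', (hd' _ hp).2⟩
  · intro a b hab h
    obtain ⟨k, hk⟩ := ha a b hab fun p hp => h p (Or.inl hp)
    have hdy : ∀ p ∈ Set.Ioo a b, f p ∈ S' → False := by
      intro p hp hpS
      refine h p (Or.inr ⟨hpS, ?_⟩) hp
      have h1 := hf'.inv.isDyadic_apply (hd' _ hpS).1
      rwa [RelIso.inv_apply_self] at h1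
    obtain ⟨k', hk'⟩ := ha' (f a) (f b) (f.monotone hab) fun p hp hpI => by
      refine hdy (f.symm p) ⟨?_, ?_⟩ (by simpa using hp)
      · exact (f.lt_symm_apply).mpr hpI.1
      · exact (f.symm_apply_lt).mpr hpI.2
    refine ⟨k' + k, fun t ht => ?_⟩
    have := hk' (f t) ⟨f.monotone ht.1, f.monotone ht.2⟩
    rw [RelIso.mul_apply, RelIso.mul_apply, this, hk t ht, zpow_add₀ two_ne_zero]
    ring
  · have h1 := hA t (ht.trans (min_le_left _ _))
    have h2 := ht.trans (min_le_right _ _)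
    rw [RelIso.mul_apply, h1, hA' _ (by linarith)]
    push_cast; ring
  · have h1 := hB t ((le_max_left _ _).trans ht)
    have h2 := (le_max_right _ _).trans ht
    rw [RelIso.mul_apply, h1, hB' _ (by linarith)]
    push_cast; ring

/-- Thompson's group `F`, realised as the group `PL₂(ℝ)`; the product is composition of maps,
`(g * f) t = g (f t)`. -/
def F : Subgroup (ℝ ≃o ℝ) where
  carrier := {f | IsPL2 f}
  mul_mem' := IsPL2.mul
  one_mem' := IsPL2.one
  inv_mem' := IsPL2.inv

/-- The translation `t ↦ t - 1`. -/
def x0Fun : ℝ ≃o ℝ where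
  toFun t := t - 1
  invFun t := t + 1
  left_inv t := by simp
  right_inv t := by simp
  map_rel_iff' := by intro a b; simp

/-- The map with `t ↦ t` for `t ≤ 0`, `t ↦ t / 2` for `0 ≤ t ≤ 2` and `t ↦ t - 1` for `2 ≤ t`. -/
def x1Fun : ℝ ≃o ℝ where
  toFun t := if t ≤ 0 then t else if t ≤ 2 then t / 2 else t - 1
  invFun t := if t ≤ 0 then t else if t ≤ 1 then 2 * t else t + 1
  left_inv t := by
    dsimp only
    split_ifs <;> linarith
  right_inv t := by
    dsimp only
    split_ifs <;> linarith
  map_rel_iff' := by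
    intro a b
    simp only [Equiv.coe_fn_mk]
    split_ifs <;> constructor <;> intro h <;> linarith

theorem x0Fun_apply (t : ℝ) : x0Fun t = t - 1 := rfl

theorem x1Fun_apply (t : ℝ) :
    x1Fun t = if t ≤ 0 then t else if t ≤ 2 then t / 2 else t - 1 := rfl

theorem isPL2_x0Fun : IsPL2 x0Fun :=
  ⟨⟨∅, Set.finite_empty, by simp, fun a b _ _ => ⟨0, fun t _ => by simp [x0Fun_apply]⟩⟩,
    ⟨1, 0, fun t _ => by simp [x0Fun_apply]⟩, ⟨1, 0, fun t _ => by simp [x0Fun_apply]⟩⟩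

theorem isPL2_x1Fun : IsPL2 x1Fun := by
  refine ⟨⟨{0, 2}, by simp, ?_, ?_⟩, ⟨0, 0, fun t ht => ?_⟩, ⟨1, 3, fun t ht => ?_⟩⟩
  · rintro p (rfl | rfl)
    · exact ⟨⟨0, 0, by simp⟩, ⟨0, 0, by simp [x1Fun_apply]⟩⟩
    · exact ⟨⟨2, 0, by simp⟩, ⟨1, 0, by simp [x1Fun_apply]⟩⟩
  · intro a b hab h
    have h0 := h 0 (by simp)
    have h2 := h 2 (by simp)
    simp only [Set.mem_Ioo, not_and, not_lt] at h0 h2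
    simp only [x1Fun_apply]
    rcases lt_or_ge a 0 with ha | ha
    · refine ⟨0, fun t ht => ?_⟩
      have := h0 ha
      rw [if_pos (by linarith [ht.2]), if_pos ha.le]
      simp
    · rcases lt_or_ge a 2 with ha2 | ha2
      · refine ⟨-1, fun t ht => ?_⟩
        have := h2 ha2
        have := ht.1
        have := ht.2
        rw [zpow_neg_one]
        split_ifs <;> linarith
      · refine ⟨0, fun t ht => ?_⟩
        have := ht.1
        rw [zpow_zero]
        split_ifs <;> linarith
  · simp [x1Fun_apply, ht]
  · rw [x1Fun_apply, if_neg (by linarith), if_neg (by linarith)]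
    simp

/-- The generator `x₀` of `F`. -/
def x0 : F := ⟨x0Fun, isPL2_x0Fun⟩

/-- The generator `x₁` of `F`. -/
def x1 : F := ⟨x1Fun, isPL2_x1Fun⟩

/-- The set of lengths of all words in the letters `S ∪ S⁻¹` whose product is `g`. The length of
`g` with respect to `S` is the least element of this set. -/
def wordLengths {G : Type*} [Group G] (S : Set G) (g : G) : Set ℕ :=
  {n | ∃ w : List G, (∀ s ∈ w, s ∈ S ∨ s⁻¹ ∈ S) ∧ w.prod = g ∧ w.length = n}

/-! ### Binary trees and bounded binary forests

A vertex of a finite binary tree is addressed by the path from the root to it, `false` meaning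
"go to the left child" and `true` meaning "go to the right child". The trivial tree `nil` is a
single leaf; each `node` is a caret. -/

/-- The path leads to a leaf of the tree. -/
def IsLeafPath : BinaryTree Unit → List Bool → Prop
  | .nil, [] => True
  | .nil, _ :: _ => False
  | .node _ _ _, [] => False
  | .node _ l _, false :: p => IsLeafPath l p
  | .node _ _ r, true :: p => IsLeafPath r p

/-- The path leads to (the top vertex of) a caret of the tree. -/
def IsCaretPath : BinaryTree Unit → List Bool → Prop
  | .nil, _ => False
  | .node _ _ _, [] => True
  | .node _ l _, false :: p => IsCaretPath l p
  | .node _ _ r, true :: p => IsCaretPath r p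

/-- The left endpoint of the standard dyadic interval, inside `[0, 1]`, of the vertex at the end
of the path: each caret cuts an interval in half. -/
def pathStart : List Bool → ℝ
  | [] => 0
  | false :: p => pathStart p / 2
  | true :: p => (1 + pathStart p) / 2

/-- A bounded binary forest: a sequence of finite binary trees indexed by `ℤ`, of which only
finitely many are nontrivial. The pointer is at the tree with index `0`. -/
structure BinaryForest where
  tree : ℤ → BinaryTree Unit
  bounded : {i | tree i ≠ .nil}.Finite

namespace BinaryForest

/-- A leaf of a forest: the index of its tree and its path in that tree. -/
def Leaf (T : BinaryForest) : Type :=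
  {q : ℤ × List Bool // IsLeafPath (T.tree q.1) q.2}

variable {T : BinaryForest}

/-- The index of the tree containing a leaf. -/
def Leaf.idx (v : T.Leaf) : ℤ := v.1.1

/-- The path from the root of its tree to a leaf. -/
def Leaf.path (v : T.Leaf) : List Bool := v.1.2

/-- The left endpoint of the interval of a leaf in the dyadic subdivision of `ℝ` given by the
forest; the `i`-th tree subdivides `[i, i + 1]`. -/
def Leaf.start (v : T.Leaf) : ℝ := v.idx + pathStart v.path

/-- The length of the interval of a leaf. -/
def Leaf.width (v : T.Leaf) : ℝ := (1 / 2) ^ v.path.length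

/-- The leaves of a forest are ordered from left to right. -/
instance : Preorder T.Leaf := Preorder.lift Leaf.start

/-- The four labels of spaces: left, necessary, right, interior. -/
inductive Label
  | L | N | R | I

/-! The spaces of a forest are the gaps between consecutive leaves. Every leaf has exactly one
space immediately to its left, so that a space is given below by the leaf on its right-hand
side. -/

/-- The space to the left of `v` is interior, that is, it lies under a tree. -/
def IsInterior (v : T.Leaf) : Prop := ∃ u : T.Leaf, u < v ∧ u.idx = v.idx

/-- The space to the left of `v` is exterior, that is, it lies between two trees. -/
def IsExterior (v : T.Leaf) : Prop := ¬ IsInterior v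

/-- The space to the left of `v` lies immediately to the left of some caret, that is, `v` is the
leftmost leaf below some caret of its tree. -/
def IsLeftOfCaret (v : T.Leaf) : Prop :=
  ∃ p : List Bool, IsCaretPath (T.tree v.idx) p ∧
    ∃ k : ℕ, v.path = p ++ List.replicate k false

open Classical in
/-- The label of the space to the left of `v`. An exterior space lies to the left of the pointer
if the tree on its right-hand side has index at most `0`. -/
def label (v : T.Leaf) : Label :=
  if IsExterior v ∧ v.idx ≤ 0 then .L
  else if IsLeftOfCaret v then .N
  else if IsExterior v then .R
  else .I

/-- The number of carets of a forest. -/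
def numCarets (T : BinaryForest) : ℕ := ∑ i ∈ T.bounded.toFinset, (T.tree i).numNodes

end BinaryForest

open BinaryForest

/-- The weight of a space with the given top and bottom labels. -/
def weight : (topLabel botLabel : Label) → ℕ
  | .L, .L => 2
  | .L, .N => 1
  | .L, .R => 1
  | .L, .I => 1
  | .N, .L => 1
  | .N, .N => 2
  | .N, .R => 2
  | .N, .I => 2
  | .R, .L => 1
  | .R, .N => 2
  | .R, .R => 2
  | .R, .I => 0
  | .I, .L => 1
  | .I, .N => 2
  | .I, .R => 0
  | .I, .I => 0

/-! ### Forest diagrams -/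

/-- A forest diagram: a pair of bounded binary forests (the bottom one for the domain, the top one
for the range) and an order-preserving bijection of their leaves. -/
structure ForestDiagram where
  bot : BinaryForest
  top : BinaryForest
  bij : bot.Leaf ≃o top.Leaf

namespace ForestDiagram

/-- `f` maps the interval of each bottom leaf linearly onto the interval of the corresponding
top leaf. -/
def Represents (𝔣 : ForestDiagram) (f : F) : Prop :=
  ∀ (v : 𝔣.bot.Leaf), ∀ s ∈ Set.Icc (0 : ℝ) 1,
    (f : ℝ ≃o ℝ) (v.start + s * v.width) = (𝔣.bij v).start + s * (𝔣.bij v).width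

/-- A diagram is reduced if it has no opposing pair of carets: no caret of the bottom forest whose
two children are leaves that correspond to the two children of a caret of the top forest. -/
def IsReduced (𝔣 : ForestDiagram) : Prop :=
  ¬ ∃ (v w : 𝔣.bot.Leaf) (i j : ℤ) (p q : List Bool),
    v.1 = (i, p ++ [false]) ∧ w.1 = (i, p ++ [true]) ∧
    (𝔣.bij v).1 = (j, q ++ [false]) ∧ (𝔣.bij w).1 = (j, q ++ [true])

/-- Column `v` (a bottom leaf together with the corresponding top leaf) belongs to one of the two
trees with a pointer or to a nontrivial tree. -/
def IsEssential (𝔣 : ForestDiagram) (v : 𝔣.bot.Leaf) : Prop :=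
  v.idx = 0 ∨ (𝔣.bij v).idx = 0 ∨
    𝔣.bot.tree v.idx ≠ .nil ∨ 𝔣.top.tree (𝔣.bij v).idx ≠ .nil

/-- The support: the minimum interval of columns containing both pointers and all nontrivial
trees. -/
def support (𝔣 : ForestDiagram) : Set 𝔣.bot.Leaf :=
  {v | ∃ a b, 𝔣.IsEssential a ∧ 𝔣.IsEssential b ∧ a ≤ v ∧ v ≤ b}

/-- The spaces of the support, each given by the column on its right-hand side: the gaps between
two consecutive columns of the support. -/
def supportSpaces (𝔣 : ForestDiagram) : Set 𝔣.bot.Leaf :=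
  {v | v ∈ 𝔣.support ∧ ∃ u ∈ 𝔣.support, u < v}

/-- The sum of the weights of the spaces in the support. -/
def ell0 (𝔣 : ForestDiagram) : ℕ :=
  ∑ᶠ v ∈ 𝔣.supportSpaces, weight (label (𝔣.bij v)) (label v)

/-- The number of carets in both forests. -/
def ell1 (𝔣 : ForestDiagram) : ℕ := 𝔣.bot.numCarets + 𝔣.top.numCarets

end ForestDiagram

/-! The support of a forest diagram is finite, so that `ell0` is an honest finite sum. -/

theorem pathStart_mem (p : List Bool) : 0 ≤ pathStart p ∧ pathStart p < 1 := by
  induction p with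
  | nil => simp [pathStart]
  | cons b p ih => cases b <;> simp only [pathStart] <;> constructor <;> linarith [ih.1, ih.2]

theorem finite_isLeafPath (t : BinaryTree Unit) : {p | IsLeafPath t p}.Finite := by
  induction t with
  | nil =>
    refine (Set.finite_singleton []).subset fun p hp => ?_
    cases p with
    | nil => rfl
    | cons b p => exact hp.elim
  | node a l r hl hr =>
    refine ((hl.image (List.cons false)).union (hr.image (List.cons true))).subset fun p hp => ?_
    match p, hp with
    | [], hp => exact hp.elim
    | false :: p, hp => exact Or.inl ⟨p, hp, rfl⟩
    | true :: p, hp => exact Or.inr ⟨p, hp, rfl⟩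

theorem BinaryForest.finite_idx (T : BinaryForest) {s : Set ℤ} (hs : s.Finite) :
    {v : T.Leaf | v.idx ∈ s}.Finite := by
  refine Set.Finite.of_finite_image (f := fun v : T.Leaf => v.1) ?_
    Subtype.val_injective.injOn
  refine (hs.biUnion fun i _ =>
    (finite_isLeafPath (T.tree i)).image (Prod.mk i)).subset ?_
  rintro _ ⟨⟨⟨i, p⟩, hp⟩, hv, rfl⟩
  exact Set.mem_biUnion hv ⟨p, hp, rfl⟩

theorem BinaryForest.idx_mono (T : BinaryForest) {u v : T.Leaf} (h : u ≤ v) : u.idx ≤ v.idx := by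
  have h' : u.start ≤ v.start := h
  unfold BinaryForest.Leaf.start at h'
  have h1 := pathStart_mem u.path
  have h2 := pathStart_mem v.path
  have : (u.idx : ℝ) < v.idx + 1 := by linarith [h1.1, h2.2]
  exact Int.lt_add_one_iff.mp (by exact_mod_cast this)

theorem ForestDiagram.finite_support (𝔣 : ForestDiagram) : 𝔣.support.Finite := by
  have hE : {v | 𝔣.IsEssential v}.Finite := by
    have h1 := 𝔣.bot.finite_idx ((Set.finite_singleton (0 : ℤ)).union 𝔣.bot.bounded)
    have h2 := (𝔣.top.finite_idx ((Set.finite_singleton (0 : ℤ)).union 𝔣.top.bounded)).preimage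
      𝔣.bij.injective.injOn
    refine (h1.union h2).subset fun v hv => ?_
    rcases hv with h | h | h | h
    · exact Or.inl (Or.inl h)
    · exact Or.inr (Or.inl h)
    · exact Or.inl (Or.inr h)
    · exact Or.inr (Or.inr h)
  refine (hE.biUnion fun a _ => hE.biUnion fun b _ =>
    𝔣.bot.finite_idx (Set.finite_Icc a.idx b.idx)).subset ?_
  rintro v ⟨a, b, ha, hb, hav, hvb⟩
  exact Set.mem_biUnion ha (Set.mem_biUnion hb ⟨𝔣.bot.idx_mono hav, 𝔣.bot.idx_mono hvb⟩)

end Thompson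

end

noncomputable section

namespace Thompson

open BinaryForest

/-! ### Standard dyadic intervals -/

/-! The formula is first rewritten in terms of the map `f` alone. A vertex of a forest is a standard
dyadic interval `[k/2ⁿ, (k+1)/2ⁿ]`, `n ≥ 0`. In the reduced diagram the bottom carets are exactly
the standard intervals that `f` does not map linearly onto standard intervals (`badSet f`), and the
top carets form `badSet f⁻¹`: see `Represents.adapted`. A space becomes a point `t` of the line
below and `f t` above, and its labels depend only on whether the point is an integer, on its sign,
and on the bad intervals starting there (`Adapted.label_eq`). A space lies outside the support
exactly when one side of it is trivial (`LeftTrivial`, `RightTrivial`). So the claimed length is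
`mapLength f` (`Represents.ell0_add_ell1`), and the same description of the carets gives existence
and uniqueness of the reduced diagram.

It remains to see that `mapLength` is the word length. It vanishes at `1`, left multiplication by a
generator changes it by exactly one (`IsGenerator.mapLength_mul`), and every `f ≠ 1` is shortened by
some generator (`exists_generator_mapLength_lt`); these facts characterise the word length.

Left multiplication by `x₀` moves the top pointer one tree to the right. No caret changes, and one
space has its top label turned from N or R into L; row L of the weight table differs by one from
rows N and R in every column. Left multiplication by `x₁` puts a caret over the top trees `0` and
`1`. If that caret survives, the space between them goes from R to I or stays N; rows R and I differ
only in column R, by two, so the length changes by `+1` or `1 - 2`. If it opposes a bottom caret,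
both disappear and no weight changes.

For the descent, look at the top tree at the pointer. If it is nontrivial, removing its root by
`x₁⁻¹` shortens `f`, except in the case of labels R, R, where `x₀` does. If it is a single leaf, the
matching bottom leaf is a whole tree, a left child or a right child, and each case has its own
generator. -/

/-- The number `a` is the left endpoint of a standard dyadic interval of width `2⁻ⁿ`. -/
def IsStd (a : ℝ) (n : ℕ) : Prop := ∃ k : ℤ, a = k * (1 / 2) ^ n

theorem isStd_zero_right {a : ℝ} : IsStd a 0 ↔ ∃ k : ℤ, a = k := by simp [IsStd]

theorem isStd_intCast (k : ℤ) (n : ℕ) : IsStd k n :=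
  ⟨k * 2 ^ n, by push_cast; rw [mul_assoc, ← mul_pow]; norm_num⟩

theorem isStd_zero (n : ℕ) : IsStd 0 n := by simpa using isStd_intCast 0 n

theorem isStd_one (n : ℕ) : IsStd 1 n := by simpa using isStd_intCast 1 n

theorem isStd_width (n : ℕ) : IsStd ((1 / 2) ^ n) n := ⟨1, by simp⟩

theorem IsStd.mono {a : ℝ} {n m : ℕ} (h : IsStd a n) (hnm : n ≤ m) : IsStd a m := by
  obtain ⟨k, rfl⟩ := h
  obtain ⟨d, rfl⟩ := Nat.exists_eq_add_of_le hnm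
  obtain ⟨j, hj⟩ := isStd_intCast k d
  exact ⟨j, by rw [hj, pow_add]; ring⟩

theorem IsStd.add {a b : ℝ} {n : ℕ} (ha : IsStd a n) (hb : IsStd b n) : IsStd (a + b) n := by
  obtain ⟨k, rfl⟩ := ha
  obtain ⟨j, rfl⟩ := hb
  exact ⟨k + j, by push_cast; ring⟩

theorem IsStd.neg {a : ℝ} {n : ℕ} (ha : IsStd a n) : IsStd (-a) n := by
  obtain ⟨k, rfl⟩ := ha
  exact ⟨-k, by push_cast; ring⟩

theorem IsStd.sub {a b : ℝ} {n : ℕ} (ha : IsStd a n) (hb : IsStd b n) : IsStd (a - b) n := by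
  rw [sub_eq_add_neg]; exact ha.add hb.neg

theorem isStd_add_one_iff {a : ℝ} {n : ℕ} : IsStd (a + 1) n ↔ IsStd a n :=
  ⟨fun h => by simpa using h.sub (isStd_one n), fun h => h.add (isStd_one n)⟩

theorem isStd_sub_one_iff {a : ℝ} {n : ℕ} : IsStd (a - 1) n ↔ IsStd a n :=
  ⟨fun h => by simpa using h.add (isStd_one n), fun h => h.sub (isStd_one n)⟩

theorem isStd_half_iff {a : ℝ} {n : ℕ} : IsStd (a / 2) (n + 1) ↔ IsStd a n := by
  refine exists_congr fun k => ?_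
  rw [pow_succ]
  constructor <;> intro h <;> linarith

theorem IsStd.add_le_of_lt {a b : ℝ} {n : ℕ} (ha : IsStd a n) (hb : IsStd b n) (h : a < b) :
    a + (1 / 2) ^ n ≤ b := by
  obtain ⟨k, rfl⟩ := ha
  obtain ⟨j, rfl⟩ := hb
  have hp : (0 : ℝ) < (1 / 2) ^ n := by positivity
  have h1 : k < j := by exact_mod_cast lt_of_mul_lt_mul_right h hp.le
  have h2 : (k : ℝ) + 1 ≤ j := by exact_mod_cast h1
  nlinarith

theorem width_lt {n m : ℕ} (h : n < m) : (1 / 2 : ℝ) ^ m < (1 / 2) ^ n :=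
  pow_lt_pow_right_of_lt_one₀ (by norm_num) (by norm_num) h

theorem width_le {n m : ℕ} (h : n ≤ m) : (1 / 2 : ℝ) ^ m ≤ (1 / 2) ^ n :=
  pow_le_pow_of_le_one (by norm_num) (by norm_num) h

theorem le_of_width_le {n m : ℕ} (h : (1 / 2 : ℝ) ^ m ≤ (1 / 2) ^ n) : n ≤ m := by
  by_contra! hc
  exact absurd h (not_le.mpr (width_lt hc))

theorem width_inj {n m : ℕ} (h : (1 / 2 : ℝ) ^ m = (1 / 2) ^ n) : m = n :=
  le_antisymm (le_of_width_le h.ge) (le_of_width_le h.le)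

theorem width_succ (n : ℕ) : (1 / 2 : ℝ) ^ (n + 1) = (1 / 2) ^ n / 2 := by
  rw [pow_succ]; ring

theorem IsStd.not_mid {a : ℝ} {n : ℕ} (ha : IsStd a n) : ¬ IsStd (a + (1 / 2) ^ (n + 1)) n := by
  intro h
  have h1 := ha.add_le_of_lt h (by simp)
  have h2 := width_lt (Nat.lt_add_one n)
  linarith

/-- The midpoint of a standard interval of depth `n` is standard only from depth `n + 1` on. This
bounds the size of the standard intervals that start at such a point. -/
theorem IsStd.lt_of_mid {a : ℝ} {n k : ℕ} (ha : IsStd a n)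
    (h : IsStd (a + (1 / 2) ^ (n + 1)) k) : n < k := by
  by_contra! hc
  exact ha.not_mid (h.mono hc)

theorem IsStd.not_isStd_zero_of_mem {a : ℝ} {x : ℝ} (ha : IsStd a 0) (h1 : a < x) (h2 : x < a + 1) :
    ¬ IsStd x 0 := by
  intro h
  have := ha.add_le_of_lt h h1
  simp only [pow_zero] at this
  linarith

/-! ### Linear correspondences between standard dyadic intervals -/

/-- `f` maps the standard dyadic interval `[a, a + 2⁻ⁿ]` linearly onto the standard dyadic interval
`[b, b + 2⁻ᵐ]`. -/
structure Corr (f : ℝ ≃o ℝ) (a : ℝ) (n : ℕ) (b : ℝ) (m : ℕ) : Prop where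
  left : IsStd a n
  right : IsStd b m
  map : ∀ s ∈ Set.Icc (0 : ℝ) 1, f (a + s * (1 / 2) ^ n) = b + s * (1 / 2) ^ m

namespace Corr

variable {f : ℝ ≃o ℝ} {a b : ℝ} {n m : ℕ}

theorem apply_left (h : Corr f a n b m) : f a = b := by
  simpa using h.map 0 (by simp)

theorem apply_right (h : Corr f a n b m) : f (a + (1 / 2) ^ n) = b + (1 / 2) ^ m := by
  simpa using h.map 1 (by simp)

theorem symm (h : Corr f a n b m) : Corr f⁻¹ b m a n :=
  ⟨h.right, h.left, fun s hs => by rw [← h.map s hs, RelIso.inv_apply_self]⟩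

theorem unique (h : Corr f a n b m) {b' : ℝ} {m' : ℕ} (h' : Corr f a n b' m') :
    b = b' ∧ m = m' := by
  have h1 : b = b' := h.apply_left.symm.trans h'.apply_left
  refine ⟨h1, width_inj (add_left_cancel (a := b) ?_)⟩
  rw [← h.apply_right, h'.apply_right, h1]

/-- Halving the source halves the target. Consequently bad intervals are closed under passing to
larger standard intervals, as the carets of a forest must be. -/
theorem sub (h : Corr f a n b m) {a' : ℝ} {n' : ℕ} (hs : IsStd a' n') (hn : n ≤ n')
    (h1 : a ≤ a') (h2 : a' < a + (1 / 2) ^ n) : ∃ b' m', Corr f a' n' b' m' := by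
  obtain ⟨d, rfl⟩ := Nat.exists_eq_add_of_le hn
  obtain ⟨j, hj⟩ := hs.sub (h.left.mono hn)
  have h3 := hs.add_le_of_lt ((h.left.add (isStd_width n)).mono hn) h2
  obtain rfl : a' = a + j * (1 / 2) ^ (n + d) := by linarith
  have hp : (0 : ℝ) < (1 / 2) ^ n := by positivity
  have hd : (0 : ℝ) < (1 / 2) ^ d := by positivity
  rw [pow_add] at h1 h3
  have hj0 : 0 ≤ (j : ℝ) * (1 / 2) ^ d := by
    refine le_of_mul_le_mul_right (a := (1 / 2 : ℝ) ^ n) ?_ hp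
    linarith
  have hj1 : ((j : ℝ) + 1) * (1 / 2) ^ d ≤ 1 := by
    refine le_of_mul_le_mul_right (a := (1 / 2 : ℝ) ^ n) ?_ hp
    linarith
  -- The subinterval lies `j` steps of relative width `2⁻ᵈ` into the source, and its image lies
  -- equally many steps into the target.
  refine ⟨b + j * (1 / 2) ^ (m + d), m + d, hs,
    (h.right.mono (Nat.le_add_right m d)).add ⟨j, rfl⟩, fun s hs' => ?_⟩
  have := h.map ((j + s) * (1 / 2) ^ d) ⟨?_, ?_⟩
  · rw [pow_add, pow_add]
    calc _ = f (a + (j + s) * (1 / 2) ^ d * (1 / 2) ^ n) := by congr 1; ring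
      _ = _ := this
      _ = _ := by ring
  · rw [add_mul]
    have := mul_nonneg hs'.1 hd.le
    linarith
  · refine le_trans (mul_le_mul_of_nonneg_right ?_ hd.le) hj1
    linarith [hs'.2]

end Corr

/-- The standard dyadic intervals that are not mapped linearly onto standard dyadic intervals. -/
def badSet (f : ℝ ≃o ℝ) : Set (ℝ × ℕ) :=
  {q | IsStd q.1 q.2 ∧ ∀ b m, ¬ Corr f q.1 q.2 b m}

theorem mem_badSet {f : ℝ ≃o ℝ} {a : ℝ} {n : ℕ} :
    (a, n) ∈ badSet f ↔ IsStd a n ∧ ∀ b m, ¬ Corr f a n b m := Iff.rfl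

theorem exists_corr_of_notMem_badSet {f : ℝ ≃o ℝ} {a : ℝ} {n : ℕ} (hs : IsStd a n)
    (h : (a, n) ∉ badSet f) : ∃ b m, Corr f a n b m := by
  by_contra! hc
  exact h ⟨hs, hc⟩

theorem Corr.notMem_badSet {f : ℝ ≃o ℝ} {a b : ℝ} {n m : ℕ} (h : Corr f a n b m) :
    (a, n) ∉ badSet f := fun hb => hb.2 _ _ h

/-- Some standard dyadic interval with left endpoint `t` is not mapped linearly onto a standard
dyadic interval. -/
def IsNecessary (f : ℝ ≃o ℝ) (t : ℝ) : Prop := ∃ n, (t, n) ∈ badSet f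

/-- By `hmin` every standard interval starting at `a` is contained in `[a, a + 2⁻ⁿ]`, so `Corr.sub`
applies to it. -/
theorem Corr.not_isNecessary {f : ℝ ≃o ℝ} {a b : ℝ} {n m : ℕ} (h : Corr f a n b m)
    (hmin : ∀ k, IsStd a k → n ≤ k) : ¬ IsNecessary f a := by
  rintro ⟨k, hk⟩
  obtain ⟨b', m', h'⟩ := h.sub hk.1 (hmin k hk.1) le_rfl (by simp)
  exact hk.2 _ _ h'

theorem exists_corr_of_not_isNecessary {f : ℝ ≃o ℝ} {a : ℝ} {n : ℕ} (hs : IsStd a n)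
    (h : ¬ IsNecessary f a) : ∃ m, Corr f a n (f a) m := by
  obtain ⟨b, m, h'⟩ := exists_corr_of_notMem_badSet hs (fun hb => h ⟨n, hb⟩)
  exact ⟨m, h'.apply_left ▸ h'⟩

/-! ### Labels and weights of points of the line -/

open Classical in
/-- The label of the space at `t` in the bottom forest of the reduced diagram for `f`. -/
def pointLabel (f : ℝ ≃o ℝ) (t : ℝ) : Label :=
  if IsStd t 0 ∧ t ≤ 0 then .L
  else if IsNecessary f t then .N
  else if IsStd t 0 then .R
  else .I

section pointLabel

variable {f : ℝ ≃o ℝ} {t : ℝ}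

theorem pointLabel_eq_L (h : IsStd t 0) (h0 : t ≤ 0) : pointLabel f t = .L := if_pos ⟨h, h0⟩

theorem pointLabel_eq_N (h0 : ¬ (IsStd t 0 ∧ t ≤ 0)) (h : IsNecessary f t) :
    pointLabel f t = .N := by
  rw [pointLabel, if_neg h0, if_pos h]

theorem pointLabel_eq_R (h : IsStd t 0) (h0 : 0 < t) (hn : ¬ IsNecessary f t) :
    pointLabel f t = .R := by
  rw [pointLabel, if_neg (fun h' => not_lt.mpr h'.2 h0), if_neg hn, if_pos h]

theorem pointLabel_eq_I (h : ¬ IsStd t 0) (hn : ¬ IsNecessary f t) :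
    pointLabel f t = .I := by
  rw [pointLabel, if_neg (fun h' => h h'.1), if_neg hn, if_neg h]

theorem pointLabel_ne_L (h0 : ¬ (IsStd t 0 ∧ t ≤ 0)) : pointLabel f t ≠ .L := by
  rw [pointLabel, if_neg h0]
  split_ifs <;> simp

theorem pointLabel_congr {f g : ℝ ≃o ℝ} {t u : ℝ} (h1 : (IsStd t 0 ∧ t ≤ 0) ↔ (IsStd u 0 ∧ u ≤ 0))
    (h2 : ¬ (IsStd t 0 ∧ t ≤ 0) → (IsStd t 0 ↔ IsStd u 0))
    (h3 : ¬ (IsStd t 0 ∧ t ≤ 0) → (IsNecessary f t ↔ IsNecessary g u)) :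
    pointLabel f t = pointLabel g u := by
  by_cases h : IsStd t 0 ∧ t ≤ 0
  · rw [pointLabel, pointLabel, if_pos h, if_pos (h1.mp h)]
  · rw [pointLabel, pointLabel, if_neg h, if_neg (fun hu => h (h1.mpr hu))]
    have h2 := h2 h
    have h3 := h3 h
    split_ifs <;> first | rfl | tauto

end pointLabel

/-- `f` is an integral translation on the half line to the left of the integer `t`, and both `t`
and `f t` are to the left of the pointers. -/
structure LeftTrivial (f : ℝ ≃o ℝ) (t : ℝ) : Prop where
  isStd : IsStd t 0
  isStd_apply : IsStd (f t) 0
  nonpos : t ≤ 0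
  apply_nonpos : f t ≤ 0
  apply_eq : ∀ s ≤ t, f s = s + (f t - t)

/-- `f` is an integral translation on the half line to the right of the integer `t`, and both `t`
and `f t` are to the right of the pointers. -/
structure RightTrivial (f : ℝ ≃o ℝ) (t : ℝ) : Prop where
  isStd : IsStd t 0
  isStd_apply : IsStd (f t) 0
  pos : 0 < t
  apply_pos : 0 < f t
  apply_eq : ∀ s ≥ t, f s = s + (f t - t)

open Classical in
/-- The contribution of the space at `t` to the length of `f`. -/
def pointWeight (f : ℝ ≃o ℝ) (t : ℝ) : ℕ :=
  if LeftTrivial f t ∨ RightTrivial f t then 0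
  else weight (pointLabel f⁻¹ (f t)) (pointLabel f t)

theorem pointWeight_of_leftTrivial {f : ℝ ≃o ℝ} {t : ℝ} (h : LeftTrivial f t) :
    pointWeight f t = 0 := if_pos (Or.inl h)

theorem pointWeight_of_rightTrivial {f : ℝ ≃o ℝ} {t : ℝ} (h : RightTrivial f t) :
    pointWeight f t = 0 := if_pos (Or.inr h)

theorem pointWeight_of_not {f : ℝ ≃o ℝ} {t : ℝ} (h : ¬ LeftTrivial f t) (h' : ¬ RightTrivial f t) :
    pointWeight f t = weight (pointLabel f⁻¹ (f t)) (pointLabel f t) := if_neg (by tauto)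

theorem pointWeight_congr {f g : ℝ ≃o ℝ} {t : ℝ} (h1 : LeftTrivial f t ↔ LeftTrivial g t)
    (h2 : RightTrivial f t ↔ RightTrivial g t)
    (h3 : weight (pointLabel f⁻¹ (f t)) (pointLabel f t) =
      weight (pointLabel g⁻¹ (g t)) (pointLabel g t)) :
    pointWeight f t = pointWeight g t := by
  rw [pointWeight, pointWeight, h3]
  split_ifs <;> first | rfl | tauto

/-- The length of `f`, in terms of the map `f` alone. -/
def mapLength (f : ℝ ≃o ℝ) : ℕ :=
  (badSet f).ncard + (badSet f⁻¹).ncard + ∑ᶠ t, pointWeight f t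

/-! ### Finiteness -/

theorem exists_uniform_nat {α : Type*} {S : Set α} (hS : S.Finite) {P : α → ℕ → Prop}
    (hmono : ∀ p n m, n ≤ m → P p n → P p m) (h : ∀ p ∈ S, ∃ n, P p n) :
    ∃ N, ∀ p ∈ S, P p N := by
  choose! n hn using h
  exact ⟨hS.toFinset.sup n, fun p hp =>
    hmono p _ _ (Finset.le_sup (hS.mem_toFinset.mpr hp)) (hn p hp)⟩

theorem isDyadic_iff_exists_isStd {a : ℝ} : IsDyadic a ↔ ∃ n, IsStd a n := by
  unfold IsDyadic IsStd
  rw [exists_comm]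
  simp only [inv_pow, div_eq_mul_inv, one_mul]

theorem exists_isStd_floor (a : ℝ) (n : ℕ) :
    ∃ a₀, IsStd a₀ n ∧ a₀ ≤ a ∧ a < a₀ + (1 / 2) ^ n := by
  refine ⟨⌊a * 2 ^ n⌋ * (1 / 2) ^ n, ⟨_, rfl⟩, ?_, ?_⟩
  · have := Int.floor_le (a * 2 ^ n)
    rw [one_div, inv_pow, ← div_eq_mul_inv, div_le_iff₀ (by positivity)]
    exact this
  · have := Int.lt_floor_add_one (a * 2 ^ n)
    rw [← add_one_mul, one_div, inv_pow, ← div_eq_mul_inv, lt_div_iff₀ (by positivity)]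
    exact this

theorem finite_isStd_Icc (n : ℕ) (x y : ℝ) : {a | IsStd a n ∧ a ∈ Set.Icc x y}.Finite := by
  refine ((Set.finite_Icc ⌈x * 2 ^ n⌉ ⌊y * 2 ^ n⌋).image
    fun k : ℤ => (k : ℝ) * (1 / 2) ^ n).subset ?_
  rintro _ ⟨⟨k, rfl⟩, h1, h2⟩
  rw [one_div, inv_pow, ← div_eq_mul_inv] at h1 h2
  rw [le_div_iff₀ (by positivity)] at h1
  rw [div_le_iff₀ (by positivity)] at h2
  exact ⟨k, ⟨Int.ceil_le.mpr h1, Int.le_floor.mpr h2⟩, rfl⟩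

/-- A slope `2 ^ e` turns depth `k` into depth `k - e`. For large `k` this is a natural number
beyond the depth `D` at which `f a` is standard. -/
theorem IsPL2.exists_corr_of_deep {f : ℝ ≃o ℝ} (hf : IsPL2 f) {a : ℝ} {n : ℕ} (ha : IsStd a n)
    {e : ℤ} (he : ∀ t ∈ Set.Icc a (a + (1 / 2) ^ n), f t = f a + (2 : ℝ) ^ e * (t - a)) :
    ∃ K, ∀ k ≥ K, ∀ a', IsStd a' k → a ≤ a' → a' < a + (1 / 2) ^ n → ∃ b m, Corr f a' k b m := by
  obtain ⟨D, hD⟩ := isDyadic_iff_exists_isStd.mp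
    (hf.isDyadic_apply (isDyadic_iff_exists_isStd.mpr ⟨n, ha⟩))
  refine ⟨n + D + e.natAbs, fun k hk a' ha' h1 h2 => ?_⟩
  obtain ⟨m, hm⟩ : ∃ m : ℕ, (m : ℤ) = k - e := ⟨(k - e).toNat, by omega⟩
  have hw : (2 : ℝ) ^ e * (1 / 2) ^ k = (1 / 2) ^ m := by
    have hk' : (k : ℤ) = m + e := by omega
    have h : ∀ j : ℕ, (1 / 2 : ℝ) ^ j = 2 ^ (-(j : ℤ)) := fun j => by simp
    rw [h, h, ← zpow_add₀ two_ne_zero, hk']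
    congr 1
    ring
  have h3 := ha'.add_le_of_lt ((ha.add (isStd_width n)).mono (by omega)) h2
  obtain ⟨j, hj⟩ := ha'.sub (ha.mono (show n ≤ k by omega))
  have hp : (0 : ℝ) < (1 / 2) ^ k := by positivity
  have hmap : ∀ s ∈ Set.Icc (0 : ℝ) 1, f (a' + s * (1 / 2) ^ k) =
      f a + j * (1 / 2) ^ m + s * (1 / 2) ^ m := by
    intro s hs
    have h4 := mul_nonneg hs.1 hp.le
    have h5 := mul_le_mul_of_nonneg_right hs.2 hp.le
    rw [he _ ⟨by linarith, by linarith⟩, ← hw, add_sub_right_comm, hj]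
    ring
  exact ⟨f a + j * (1 / 2) ^ m, m, ha', (hD.mono (by omega)).add ⟨j, rfl⟩, hmap⟩

theorem corr_of_translation {f : ℝ ≃o ℝ} {a : ℝ} {m : ℤ} (ha : IsStd a 0)
    (h : ∀ t ∈ Set.Icc a (a + 1), f t = t - m) : Corr f a 0 (a - m) 0 := by
  refine ⟨ha, ha.sub (isStd_intCast m 0), fun s hs => ?_⟩
  rw [h _ ⟨by simpa using hs.1, by simpa using hs.2⟩]
  ring

/-- Far out, `f` is an integral translation and no interval is bad. In between, cutting at a depth
`N` at which all breakpoints are standard leaves linear pieces, on which only intervals of bounded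
depth can be bad. Finiteness matters because `ncard` is `0` on infinite sets. -/
theorem IsPL2.finite_badSet {f : ℝ ≃o ℝ} (hf : IsPL2 f) : (badSet f).Finite := by
  have hf' := hf
  obtain ⟨⟨S, hS, hd, hlin⟩, ⟨m, A, hA⟩, ⟨n, B, hB⟩⟩ := hf
  obtain ⟨N, hN⟩ := exists_uniform_nat hS (P := IsStd) (fun p n m h h' => h'.mono h)
    fun p hp => isDyadic_iff_exists_isStd.mp (hd p hp).1
  -- The margin on the left is two units: one for the unit interval around a bad starting point, one
  -- for rounding that point down to depth `N`.
  have hloc : ∀ a ∈ {a | IsStd a N ∧ a ∈ Set.Icc (A - 2) (B + 1)}, ∃ K, ∀ k ≥ K, ∀ a', IsStd a' k →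
      a ≤ a' → a' < a + (1 / 2) ^ N → ∃ b m, Corr f a' k b m := by
    rintro a ⟨ha, -⟩
    obtain ⟨e, he⟩ := hlin a (a + (1 / 2) ^ N) (by simp) fun p hp hpI =>
      not_lt.mpr (ha.add_le_of_lt (hN p hp) hpI.1) hpI.2
    exact hf'.exists_corr_of_deep ha he
  obtain ⟨K, hK⟩ := exists_uniform_nat (finite_isStd_Icc N (A - 2) (B + 1))
    (P := fun a K => ∀ k ≥ K, ∀ a', IsStd a' k → a ≤ a' → a' < a + (1 / 2) ^ N →
      ∃ b m, Corr f a' k b m) (fun p n m h h' k hk => h' k (h.trans hk)) hloc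
  refine ((Set.finite_Iio K).biUnion fun k _ =>
    (finite_isStd_Icc k (A - 1) (B + 1)).image fun a => (a, k)).subset ?_
  rintro ⟨a, k⟩ ⟨hs, hbad⟩
  have hI : a ∈ Set.Icc (A - 1) (B + 1) := by
    obtain ⟨i, hi, h1, h2⟩ := exists_isStd_floor a 0
    rw [pow_zero] at h2
    constructor
    · by_contra! hc
      obtain ⟨b, l, h⟩ := (corr_of_translation hi (m := m) fun t ht => hA t
        (by linarith [ht.2])).sub hs (Nat.zero_le k) h1 (by simpa using h2)
      exact hbad _ _ h
    · by_contra! hc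
      obtain ⟨b, l, h⟩ := (corr_of_translation hi (m := n) fun t ht => hB t
        (by linarith [ht.1])).sub hs (Nat.zero_le k) h1 (by simpa using h2)
      exact hbad _ _ h
  refine Set.mem_biUnion (x := k) ?_ ⟨a, ⟨hs, hI⟩, rfl⟩
  by_contra! hk
  obtain ⟨a₀, ha₀, h1, h2⟩ := exists_isStd_floor a N
  have : (1 / 2 : ℝ) ^ N ≤ 1 := by simpa using width_le (Nat.zero_le N)
  obtain ⟨b, l, h⟩ := hK a₀ ⟨ha₀, by linarith [hI.1], by linarith [hI.2]⟩ k (not_lt.mp hk) a hs h1 h2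
  exact hbad _ _ h

/-- Apart from the finitely many points with a label N, positive weight requires `t` or `f t` to be
an integer, and far out such a point is trivial. Without finite support the `finsum` in `mapLength`
would be `0` by default. -/
theorem IsPL2.finite_support_pointWeight {f : ℝ ≃o ℝ} (hf : IsPL2 f) :
    (Function.support (pointWeight f)).Finite := by
  have hbad := hf.finite_badSet
  have hbad' := hf.inv.finite_badSet
  obtain ⟨-, ⟨m, A, hA⟩, ⟨n, B, hB⟩⟩ := hf
  -- `M` exceeds the translation lengths too, so that beyond `±M` the points `t` and `f t` are on
  -- the same side of `0`.
  obtain ⟨M, hM⟩ : ∃ M : ℝ, M = |A| + |B| + |(m : ℝ)| + |(n : ℝ)| + 1 := ⟨_, rfl⟩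
  have h1 := abs_nonneg A
  have h2 := abs_nonneg B
  have h3 := abs_nonneg (m : ℝ)
  have h4 := abs_nonneg (n : ℝ)
  have hMA : |A| < M := by linarith
  have hMB : |B| < M := by linarith
  have hMm : |(m : ℝ)| < M := by linarith
  have hMn : |(n : ℝ)| < M := by linarith
  clear h1 h2 h3 h4
  rw [abs_lt] at hMA hMB hMm hMn
  refine ((((hbad.image Prod.fst).union ((hbad'.image Prod.fst).preimage f.injective.injOn))).union
    ((finite_isStd_Icc 0 (-M) M).union
      ((finite_isStd_Icc 0 (f (-M)) (f M)).preimage f.injective.injOn))).subset fun t ht => ?_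
  by_cases h1 : IsNecessary f t
  · obtain ⟨k, hk⟩ := h1
    exact Or.inl (Or.inl ⟨_, hk, rfl⟩)
  by_cases h2 : IsNecessary f⁻¹ (f t)
  · obtain ⟨k, hk⟩ := h2
    exact Or.inl (Or.inr ⟨_, hk, rfl⟩)
  right
  have hint : IsStd t 0 ∨ IsStd (f t) 0 := by
    by_contra! hc
    refine ht ?_
    rw [pointWeight, pointLabel_eq_I hc.1 h1, pointLabel_eq_I hc.2 h2]
    simp [weight]
  have hI : t ∈ Set.Icc (-M) M := by
    constructor
    · by_contra! hc
      have hft := hA t (by linarith)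
      have hst : IsStd t 0 := by
        refine hint.elim id fun h => ?_
        rw [hft] at h
        simpa using h.add (isStd_intCast m 0)
      refine ht (pointWeight_of_leftTrivial ⟨hst, ?_, by linarith, by linarith, fun s hs => ?_⟩)
      · rw [hft]; exact hst.sub (isStd_intCast m 0)
      · rw [hft, hA s (by linarith)]; ring
    · by_contra! hc
      have hft := hB t (by linarith)
      have hst : IsStd t 0 := by
        refine hint.elim id fun h => ?_
        rw [hft] at h
        simpa using h.add (isStd_intCast n 0)
      refine ht (pointWeight_of_rightTrivial ⟨hst, ?_, by linarith, by linarith, fun s hs => ?_⟩)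
      · rw [hft]; exact hst.sub (isStd_intCast n 0)
      · rw [hft, hB s (by linarith)]; ring
  exact hint.imp (fun h => ⟨h, hI⟩) fun h => ⟨h, f.monotone hI.1, f.monotone hI.2⟩

/-! ### Composition of correspondences -/

section comp

variable {f g : ℝ ≃o ℝ} {a b c : ℝ} {n m k : ℕ}

theorem Corr.comp (hg : Corr g b m c k) (hf : Corr f a n b m) : Corr (g * f) a n c k :=
  ⟨hf.left, hg.right, fun s hs => by rw [RelIso.mul_apply, hf.map s hs, hg.map s hs]⟩

theorem corr_inv_iff : Corr f⁻¹ b m a n ↔ Corr f a n b m :=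
  ⟨fun h => by simpa using h.symm, Corr.symm⟩

theorem Corr.comp_iff (hg : Corr g b m c k) : Corr (g * f) a n c k ↔ Corr f a n b m :=
  ⟨fun h => by simpa using hg.symm.comp h, hg.comp⟩

theorem mem_badSet_inv : (b, m) ∈ badSet f⁻¹ ↔ IsStd b m ∧ ∀ a n, ¬ Corr f a n b m := by
  simp only [mem_badSet, corr_inv_iff]

theorem Corr.mem_badSet_inv_mul_iff (hg : Corr g b m c k) :
    (c, k) ∈ badSet (g * f)⁻¹ ↔ (b, m) ∈ badSet f⁻¹ := by
  simp only [mem_badSet_inv, hg.comp_iff, hg.left, hg.right]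

end comp

/-- Used to compare two total weights that differ at one space only; the additive form avoids
truncated subtraction. -/
theorem finsum_add_eq_of_eq_off {α : Type*} {w w' : α → ℕ} (hw : (Function.support w).Finite)
    (hw' : (Function.support w').Finite) {t : α} (h : ∀ s, s ≠ t → w s = w' s) :
    ∑ᶠ s, w s + w' t = ∑ᶠ s, w' s + w t := by
  have h' : ∑ᶠ (s) (_ : s ≠ t), w s = ∑ᶠ (s) (_ : s ≠ t), w' s :=
    finsum_congr fun s => finsum_congr fun hs => h s hs
  rw [← add_finsum_cond_ne t hw, ← add_finsum_cond_ne t hw', h']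
  ring

theorem IsStd.one_le {a : ℝ} (h : IsStd a 0) (h0 : 0 < a) : 1 ≤ a := by
  simpa using (isStd_zero 0).add_le_of_lt h h0

theorem IsStd.two_le {a : ℝ} (h : IsStd a 0) (h0 : 0 < a) (h1 : a ≠ 1) : 2 ≤ a := by
  have h2 := (isStd_one 0).add_le_of_lt h (lt_of_le_of_ne (h.one_le h0) (Ne.symm h1))
  rw [pow_zero] at h2
  linarith

theorem IsStd.nonpos_of_lt_one {a : ℝ} (h : IsStd a 0) (h0 : a < 1) : a ≤ 0 := by
  by_contra! hc
  linarith [h.one_le hc]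

theorem RightTrivial.corr {f : ℝ ≃o ℝ} {t : ℝ} (h : RightTrivial f t) : Corr f t 0 (f t) 0 := by
  refine ⟨h.isStd, h.isStd_apply, fun s hs => ?_⟩
  rw [h.apply_eq _ (by simpa using hs.1)]
  ring

theorem RightTrivial.pointLabel_eq {f : ℝ ≃o ℝ} {t : ℝ} (h : RightTrivial f t) :
    pointLabel f t = .R :=
  pointLabel_eq_R h.isStd h.pos (h.corr.not_isNecessary fun _ _ => Nat.zero_le _)

theorem RightTrivial.pointLabel_inv_eq {f : ℝ ≃o ℝ} {t : ℝ} (h : RightTrivial f t) :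
    pointLabel f⁻¹ (f t) = .R :=
  pointLabel_eq_R h.isStd_apply h.apply_pos
    (h.corr.symm.not_isNecessary fun _ _ => Nat.zero_le _)

/-! ### Multiplication by the first generator -/

section x0

variable {f : ℝ ≃o ℝ} {t : ℝ}

theorem corr_x0Fun {b : ℝ} {m : ℕ} (h : IsStd b m) : Corr x0Fun b m (b - 1) m :=
  ⟨h, isStd_sub_one_iff.mpr h, fun s _ => by rw [x0Fun_apply]; ring⟩

theorem badSet_x0Fun_mul (f : ℝ ≃o ℝ) : badSet (x0Fun * f) = badSet f := by
  ext ⟨a, n⟩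
  refine and_congr_right fun _ => ⟨fun h b m hc => h _ _ ((corr_x0Fun hc.right).comp hc),
    fun h c k hc => h (c + 1) k ?_⟩
  refine (Corr.comp_iff ?_).mp hc
  simpa using corr_x0Fun (hc.right.add (isStd_one k))

theorem mem_badSet_x0Fun_mul_inv {b : ℝ} {m : ℕ} :
    (b - 1, m) ∈ badSet (x0Fun * f)⁻¹ ↔ (b, m) ∈ badSet f⁻¹ := by
  by_cases h : IsStd b m
  · exact (corr_x0Fun h).mem_badSet_inv_mul_iff
  · exact iff_of_false (fun h' => h (isStd_sub_one_iff.mp h'.1)) fun h' => h h'.1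

theorem ncard_badSet_x0Fun_mul_inv (f : ℝ ≃o ℝ) :
    (badSet (x0Fun * f)⁻¹).ncard = (badSet f⁻¹).ncard := by
  symm
  refine Set.ncard_congr (fun q _ => (q.1 - 1, q.2))
    (fun q hq => mem_badSet_x0Fun_mul_inv.mpr hq) ?_ fun q hq => ?_
  · rintro ⟨a, n⟩ ⟨b, m⟩ _ _ h
    simpa using h
  · exact ⟨(q.1 + 1, q.2), mem_badSet_x0Fun_mul_inv.mp (by simpa using hq), by simp⟩

/-- The shift by one carries only the integer `1` across the pointer. -/
theorem pointLabel_x0Fun_mul_inv (h : f t ≠ 1) :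
    pointLabel (x0Fun * f)⁻¹ ((x0Fun * f) t) = pointLabel f⁻¹ (f t) := by
  rw [RelIso.mul_apply, x0Fun_apply]
  refine pointLabel_congr ?_ (fun _ => isStd_sub_one_iff)
    fun _ => exists_congr fun n => mem_badSet_x0Fun_mul_inv
  rw [isStd_sub_one_iff]
  refine and_congr_right fun hs => ⟨fun h' => hs.nonpos_of_lt_one ?_, fun h' => by linarith⟩
  exact lt_of_le_of_ne (by linarith) h

theorem pointLabel_x0Fun_mul (f : ℝ ≃o ℝ) (t : ℝ) :
    pointLabel (x0Fun * f) t = pointLabel f t := by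
  unfold pointLabel IsNecessary
  rw [badSet_x0Fun_mul]

theorem leftTrivial_x0Fun_mul (h : f t ≠ 1) : LeftTrivial (x0Fun * f) t ↔ LeftTrivial f t := by
  constructor
  · rintro ⟨h1, h2, h3, h4, h5⟩
    simp only [RelIso.mul_apply, x0Fun_apply] at h2 h4 h5
    rw [isStd_sub_one_iff] at h2
    exact ⟨h1, h2, h3, h2.nonpos_of_lt_one (lt_of_le_of_ne (by linarith) h),
      fun s hs => by linarith [h5 s hs]⟩
  · rintro ⟨h1, h2, h3, h4, h5⟩
    refine ⟨h1, isStd_sub_one_iff.mpr h2, h3, ?_, fun s hs => ?_⟩ <;>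
      simp only [RelIso.mul_apply, x0Fun_apply]
    · linarith
    · linarith [h5 s hs]

theorem rightTrivial_x0Fun_mul (h : f t ≠ 1) : RightTrivial (x0Fun * f) t ↔ RightTrivial f t := by
  constructor
  · rintro ⟨h1, h2, h3, h4, h5⟩
    simp only [RelIso.mul_apply, x0Fun_apply] at h2 h4 h5
    rw [isStd_sub_one_iff] at h2
    exact ⟨h1, h2, h3, by linarith, fun s hs => by linarith [h5 s hs]⟩
  · rintro ⟨h1, h2, h3, h4, h5⟩
    have := h2.two_le h4 h
    refine ⟨h1, isStd_sub_one_iff.mpr h2, h3, ?_, fun s hs => ?_⟩ <;>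
      simp only [RelIso.mul_apply, x0Fun_apply]
    · linarith
    · linarith [h5 s hs]

theorem pointWeight_x0Fun_mul (h : f t ≠ 1) :
    pointWeight (x0Fun * f) t = pointWeight f t :=
  pointWeight_congr (leftTrivial_x0Fun_mul h) (rightTrivial_x0Fun_mul h)
    (by rw [pointLabel_x0Fun_mul_inv h, pointLabel_x0Fun_mul])

theorem mapLength_x0Fun_mul_add (hf : IsPL2 f) (ht : f t = 1) :
    mapLength (x0Fun * f) + pointWeight f t = mapLength f + pointWeight (x0Fun * f) t := by
  have := finsum_add_eq_of_eq_off (isPL2_x0Fun.mul hf).finite_support_pointWeight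
    hf.finite_support_pointWeight (t := t) fun s hs =>
      pointWeight_x0Fun_mul fun h => hs (f.injective (h.trans ht.symm))
  rw [mapLength, mapLength, badSet_x0Fun_mul, ncard_badSet_x0Fun_mul_inv]
  omega

/-- The space at `1` of the top forest lies to the right of the pointer. -/
theorem pointWeight_of_apply_eq_one (ht : f t = 1) (h : ¬ RightTrivial f t) :
    pointWeight f t = weight (pointLabel f⁻¹ 1) (pointLabel f t) := by
  rw [pointWeight_of_not (fun h' => ?_) h, ht]
  have := h'.apply_nonpos
  linarith

/-- The space at `0` of the top forest lies to the left of the pointer. -/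
theorem pointWeight_of_apply_eq_zero (ht : f t = 0) (h : ¬ LeftTrivial f t) :
    pointWeight f t = weight .L (pointLabel f t) := by
  rw [pointWeight_of_not h (fun h' => ?_), ht, pointLabel_eq_L (isStd_zero 0) le_rfl]
  have := h'.apply_pos
  linarith

theorem x0Fun_mul_apply_of_eq_one (ht : f t = 1) : (x0Fun * f) t = 0 := by
  rw [RelIso.mul_apply, ht, x0Fun_apply, sub_self]

theorem pointLabel_one (g : ℝ ≃o ℝ) : pointLabel g 1 = .N ∨ pointLabel g 1 = .R := by
  by_cases h : IsNecessary g 1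
  · exact Or.inl (pointLabel_eq_N (fun h' => by linarith [h'.2]) h)
  · exact Or.inr (pointLabel_eq_R (isStd_one 0) one_pos h)

/-- At height `1` the top label N or R is replaced by L, and row L of the table is off by one from
both rows everywhere. The trivial spaces fit in: weight `0` on the right becomes the entry (L, R) `=
1`, and an entry in column L, which is `1`, becomes `0` on the left. -/
theorem pointWeight_x0Fun_mul_sub (ht : f t = 1) :
    pointWeight (x0Fun * f) t = pointWeight f t + 1 ∨
      pointWeight f t = pointWeight (x0Fun * f) t + 1 := by
  have ht' := x0Fun_mul_apply_of_eq_one ht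
  by_cases hr : RightTrivial f t
  · have hl : ¬ LeftTrivial (x0Fun * f) t := fun h => absurd h.nonpos (not_le.mpr hr.pos)
    rw [pointWeight_of_rightTrivial hr, pointWeight_of_apply_eq_zero ht' hl, pointLabel_x0Fun_mul,
      hr.pointLabel_eq]
    simp [weight]
  rw [pointWeight_of_apply_eq_one ht hr]
  by_cases hl : LeftTrivial (x0Fun * f) t
  · rw [pointWeight_of_leftTrivial hl, pointLabel_eq_L hl.isStd hl.nonpos]
    rcases pointLabel_one f⁻¹ with h | h <;> simp [h, weight]
  · rw [pointWeight_of_apply_eq_zero ht' hl, pointLabel_x0Fun_mul]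
    rcases pointLabel_one f⁻¹ with h | h <;> rw [h] <;> cases pointLabel f t <;> simp [weight]

theorem mapLength_x0Fun_mul (hf : IsPL2 f) :
    mapLength (x0Fun * f) = mapLength f + 1 ∨ mapLength f = mapLength (x0Fun * f) + 1 := by
  obtain ⟨t, ht⟩ := f.surjective 1
  have h1 := mapLength_x0Fun_mul_add hf ht
  rcases pointWeight_x0Fun_mul_sub ht with h | h <;> omega

end x0

/-! ### Multiplication by the second generator -/

theorem x1Fun_of_nonpos {r : ℝ} (h : r ≤ 0) : x1Fun r = r := by
  rw [x1Fun_apply, if_pos h]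

theorem x1Fun_of_mem {r : ℝ} (h : 0 ≤ r) (h' : r ≤ 2) : x1Fun r = r / 2 := by
  rw [x1Fun_apply]
  split_ifs <;> linarith

theorem x1Fun_of_two_le {r : ℝ} (h : 2 ≤ r) : x1Fun r = r - 1 := by
  rw [x1Fun_apply]
  split_ifs <;> linarith

theorem x1Fun_nonpos_iff {r : ℝ} : x1Fun r ≤ 0 ↔ r ≤ 0 := by
  rw [x1Fun_apply]
  split_ifs <;> constructor <;> intro h <;> linarith

theorem one_le_x1Fun_iff {r : ℝ} : 1 ≤ x1Fun r ↔ 2 ≤ r := by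
  rw [x1Fun_apply]
  split_ifs <;> constructor <;> intro h <;> linarith

theorem isStd_x1Fun_iff {r : ℝ} (h : r ≠ 1) : IsStd (x1Fun r) 0 ↔ IsStd r 0 := by
  rcases le_or_gt r 0 with h0 | h0
  · rw [x1Fun_of_nonpos h0]
  rcases lt_or_ge r 2 with h2 | h2
  · refine iff_of_false (fun hs => ?_) fun hs => ?_
    · have := hs.one_le (not_le.mp fun h' => not_le.mpr h0 (x1Fun_nonpos_iff.mp h'))
      linarith [one_le_x1Fun_iff.mp this]
    · linarith [hs.two_le h0 h]
  · rw [x1Fun_of_two_le h2, isStd_sub_one_iff]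

open Classical in
/-- The change of the depth of a standard dyadic interval starting at `b` under `x₁`. -/
def x1Shift (b : ℝ) : ℕ := if 0 ≤ b ∧ b < 2 then 1 else 0

theorem corr_x1Fun {b : ℝ} {m : ℕ} (h : IsStd b m) :
    Corr x1Fun b m (x1Fun b) (m + x1Shift b) := by
  have hp : (0 : ℝ) < (1 / 2) ^ m := by positivity
  by_cases hb : 0 ≤ b ∧ b < 2
  · have h1 : x1Shift b = 1 := if_pos hb
    have h2 : IsStd 2 m := by simpa using isStd_intCast 2 m
    have h3 := h.add_le_of_lt h2 hb.2
    rw [h1, x1Fun_of_mem hb.1 hb.2.le]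
    refine ⟨h, isStd_half_iff.mpr h, fun s hs => ?_⟩
    have h4 := mul_nonneg hs.1 hp.le
    have h5 := mul_le_mul_of_nonneg_right hs.2 hp.le
    rw [x1Fun_of_mem (by linarith) (by linarith), width_succ]
    ring
  · have h1 : x1Shift b = 0 := if_neg hb
    rw [h1, add_zero]
    rcases lt_or_ge b 0 with h0 | h0
    · have h3 := h.add_le_of_lt (isStd_zero m) h0
      rw [x1Fun_of_nonpos h0.le]
      refine ⟨h, h, fun s hs => ?_⟩
      have h5 := mul_le_mul_of_nonneg_right hs.2 hp.le
      rw [x1Fun_of_nonpos (by linarith)]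
    · have h2 : 2 ≤ b := by
        by_contra! hc
        exact hb ⟨h0, hc⟩
      rw [x1Fun_of_two_le h2]
      refine ⟨h, isStd_sub_one_iff.mpr h, fun s hs => ?_⟩
      have h4 := mul_nonneg hs.1 hp.le
      rw [x1Fun_of_two_le (by linarith)]
      ring

/-- Only `[0, 1]` is excluded: its preimage `[0, 2]` is too wide to be a standard interval. -/
theorem exists_corr_x1Fun {c : ℝ} {k : ℕ} (h : IsStd c k) (hne : ¬ (c = 0 ∧ k = 0)) :
    ∃ b m, Corr x1Fun b m c k := by
  rcases lt_or_ge c 0 with h0 | h0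
  · have := corr_x1Fun h
    rw [x1Fun_of_nonpos h0.le, x1Shift, if_neg (fun h' => by linarith [h'.1])] at this
    exact ⟨_, _, this⟩
  rcases lt_or_ge c 1 with h1 | h1
  · cases k with
    | zero => exact absurd ⟨le_antisymm (h.nonpos_of_lt_one h1) h0, rfl⟩ hne
    | succ k =>
      have h2 : IsStd (2 * c) k := by
        rw [← isStd_half_iff]
        simpa using h
      have := corr_x1Fun h2
      rw [x1Fun_of_mem (by linarith) (by linarith), x1Shift,
        if_pos ⟨by linarith, by linarith⟩, mul_div_cancel_left₀ _ two_ne_zero] at this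
      exact ⟨_, _, this⟩
  · have := corr_x1Fun (isStd_add_one_iff.mpr h)
    rw [x1Fun_of_two_le (by linarith), x1Shift, if_neg (fun h' => by linarith [h'.2]),
      add_sub_cancel_right] at this
    exact ⟨_, _, this⟩

section x1

variable {f : ℝ ≃o ℝ} {t : ℝ}

/-- The interval `[0, 1]` is not the image of a standard dyadic interval under `x₁`. -/
theorem not_corr_x1Fun_zero {b : ℝ} {m : ℕ} : ¬ Corr x1Fun b m 0 0 := by
  intro h
  have h1 := (corr_x1Fun h.left).unique h
  have h0 : b = 0 := x1Fun.injective (h.apply_left.trans (x1Fun_of_nonpos le_rfl).symm)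
  have : x1Shift b = 1 := if_pos (by rw [h0]; norm_num)
  omega

theorem Corr.x1Fun_mul {a b : ℝ} {n m : ℕ} (h : Corr f a n b m) :
    ∃ c k, Corr (x1Fun * f) a n c k ∧ ¬ (c = 0 ∧ k = 0) := by
  refine ⟨_, _, (corr_x1Fun h.right).comp h, ?_⟩
  rintro ⟨h1, h2⟩
  have := corr_x1Fun h.right
  rw [h1, h2] at this
  exact not_corr_x1Fun_zero this

theorem Corr.of_x1Fun_mul {a c : ℝ} {n k : ℕ} (h : Corr (x1Fun * f) a n c k)
    (hne : ¬ (c = 0 ∧ k = 0)) : ∃ b m, Corr f a n b m := by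
  obtain ⟨b, m, hb⟩ := exists_corr_x1Fun h.right hne
  exact ⟨b, m, hb.comp_iff.mp h⟩

/-- `x₁` matches the standard intervals starting at `r` with those starting at `x₁ r`, except that
at `0` the possible new caret `[0, 1]` has no counterpart. -/
theorem isNecessary_x1Fun_mul_inv {r : ℝ} (h0 : r ≠ 0) :
    IsNecessary (x1Fun * f)⁻¹ (x1Fun r) ↔ IsNecessary f⁻¹ r := by
  constructor
  · rintro ⟨k, hk⟩
    obtain ⟨b, m, hb⟩ := exists_corr_x1Fun hk.1 (fun h => h0 (x1Fun.injective
      (h.1.trans (x1Fun_of_nonpos le_rfl).symm)))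
    have : b = r := x1Fun.injective hb.apply_left
    subst this
    exact ⟨m, hb.mem_badSet_inv_mul_iff.mp hk⟩
  · rintro ⟨m, hm⟩
    exact ⟨_, (corr_x1Fun hm.1).mem_badSet_inv_mul_iff.mpr hm⟩

theorem pointLabel_x1Fun_mul_inv (h : f t ≠ 1) :
    pointLabel (x1Fun * f)⁻¹ ((x1Fun * f) t) = pointLabel f⁻¹ (f t) := by
  rw [RelIso.mul_apply]
  refine pointLabel_congr (by rw [isStd_x1Fun_iff h, x1Fun_nonpos_iff])
    (fun _ => isStd_x1Fun_iff h) fun hL => isNecessary_x1Fun_mul_inv fun h0 => hL ?_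
  rw [h0, x1Fun_of_nonpos le_rfl]
  exact ⟨isStd_zero 0, le_rfl⟩

theorem leftTrivial_x1Fun_mul : LeftTrivial (x1Fun * f) t ↔ LeftTrivial f t := by
  have key : f t ≤ 0 → (LeftTrivial (x1Fun * f) t ↔ LeftTrivial f t) := by
    intro h
    have h' : ∀ s ≤ t, (x1Fun * f) s = f s := fun s hs =>
      x1Fun_of_nonpos ((f.monotone hs).trans h)
    constructor
    · rintro ⟨h1, h2, h3, h4, h5⟩
      rw [h' t le_rfl] at h2 h4
      refine ⟨h1, h2, h3, h4, fun s hs => ?_⟩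
      rw [← h' s hs, h5 s hs, h' t le_rfl]
    · rintro ⟨h1, h2, h3, h4, h5⟩
      refine ⟨h1, by rwa [h' t le_rfl], h3, by rwa [h' t le_rfl], fun s hs => ?_⟩
      rw [h' s hs, h5 s hs, h' t le_rfl]
  exact ⟨fun h => (key (x1Fun_nonpos_iff.mp h.apply_nonpos)).mp h,
    fun h => (key h.apply_nonpos).mpr h⟩

theorem rightTrivial_x1Fun_mul (hne : f t ≠ 1) :
    RightTrivial (x1Fun * f) t ↔ RightTrivial f t := by
  have key : 2 ≤ f t → (RightTrivial (x1Fun * f) t ↔ RightTrivial f t) := by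
    intro h
    have h' : ∀ s ≥ t, (x1Fun * f) s = f s - 1 := fun s hs =>
      x1Fun_of_two_le (h.trans (f.monotone hs))
    constructor
    · rintro ⟨h1, h2, h3, h4, h5⟩
      rw [h' t le_rfl] at h2 h4
      refine ⟨h1, isStd_sub_one_iff.mp h2, h3, by linarith, fun s hs => ?_⟩
      have := h5 s hs
      rw [h' s hs, h' t le_rfl] at this
      linarith
    · rintro ⟨h1, h2, h3, h4, h5⟩
      refine ⟨h1, by rwa [h' t le_rfl, isStd_sub_one_iff], h3, ?_, fun s hs => ?_⟩
      · rw [h' t le_rfl]; linarith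
      · rw [h' s hs, h5 s hs, h' t le_rfl]; ring
  exact ⟨fun h => (key (one_le_x1Fun_iff.mp (h.isStd_apply.one_le h.apply_pos))).mp h,
    fun h => (key (h.isStd_apply.two_le h.apply_pos hne)).mpr h⟩

theorem not_isStd_half : ¬ IsStd (1 / 2) 0 :=
  (isStd_zero 0).not_isStd_zero_of_mem (by norm_num) (by norm_num)

theorem x1Fun_one : x1Fun 1 = 1 / 2 := by
  rw [x1Fun_of_mem (by norm_num) (by norm_num)]

theorem x1Fun_mul_apply_of_eq_one (ht : f t = 1) : (x1Fun * f) t = 1 / 2 := by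
  rw [RelIso.mul_apply, ht, x1Fun_one]

theorem pointWeight_x1Fun_mul_of_eq_one (ht : f t = 1) :
    pointWeight (x1Fun * f) t =
      weight (pointLabel (x1Fun * f)⁻¹ (1 / 2)) (pointLabel (x1Fun * f) t) := by
  have ht' := x1Fun_mul_apply_of_eq_one ht
  rw [pointWeight_of_not (fun h => not_isStd_half (ht' ▸ h.isStd_apply))
    (fun h => not_isStd_half (ht' ▸ h.isStd_apply)), ht']

/-- The new caret makes the space between the two joined trees interior without changing whether a
caret starts there. -/
theorem pointLabel_x1Fun_mul_inv_half :
    (pointLabel f⁻¹ 1 = .N ∧ pointLabel (x1Fun * f)⁻¹ (1 / 2) = .N) ∨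
      (pointLabel f⁻¹ 1 = .R ∧ pointLabel (x1Fun * f)⁻¹ (1 / 2) = .I) := by
  have h := isNecessary_x1Fun_mul_inv (f := f) one_ne_zero
  rw [x1Fun_one] at h
  by_cases hN : IsNecessary f⁻¹ 1
  · exact Or.inl ⟨pointLabel_eq_N (fun h' => by linarith [h'.2]) hN,
      pointLabel_eq_N (fun h' => not_isStd_half h'.1) (h.mpr hN)⟩
  · exact Or.inr ⟨pointLabel_eq_R (isStd_one 0) one_pos hN,
      pointLabel_eq_I not_isStd_half (fun h' => hN (h.mp h'))⟩

/-- The image of a standard dyadic interval under the action of `x₁`. -/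
def x1Map (q : ℝ × ℕ) : ℝ × ℕ := (x1Fun q.1, q.2 + x1Shift q.1)

theorem x1Map_injective : Function.Injective x1Map := by
  rintro ⟨a, n⟩ ⟨b, m⟩ h
  simp only [x1Map, Prod.mk.injEq] at h
  obtain ⟨h1, h2⟩ := h
  obtain rfl : a = b := x1Fun.injective h1
  simpa using h2

theorem zero_notMem_x1Map_image (f : ℝ ≃o ℝ) : ((0 : ℝ), 0) ∉ x1Map '' badSet f⁻¹ := by
  rintro ⟨⟨b, m⟩, hb, h⟩
  simp only [x1Map, Prod.mk.injEq] at h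
  have := corr_x1Fun hb.1
  simp only [h] at this
  exact not_corr_x1Fun_zero this

theorem mem_badSet_x1Fun_mul_inv {q : ℝ × ℕ} (hq : q ≠ (0, 0)) :
    q ∈ badSet (x1Fun * f)⁻¹ ↔ q ∈ x1Map '' badSet f⁻¹ := by
  obtain ⟨c, k⟩ := q
  constructor
  · intro h
    obtain ⟨b, m, hb⟩ := exists_corr_x1Fun h.1 (fun h' => hq (Prod.ext h'.1 h'.2))
    refine ⟨(b, m), hb.mem_badSet_inv_mul_iff.mp h, ?_⟩
    obtain ⟨h1, h2⟩ := (corr_x1Fun hb.left).unique hb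
    rw [x1Map, h1, h2]
  · rintro ⟨⟨b, m⟩, hb, h⟩
    rw [← h]
    exact (corr_x1Fun hb.1).mem_badSet_inv_mul_iff.mpr hb

/-- No standard interval is mapped onto `[0, 1]` here, and `[0, 1]` is the only target that cannot
be pulled back through `x₁`. So the bottom forest is unaffected. -/
theorem badSet_x1Fun_mul_of_mem (h : ((0 : ℝ), 0) ∈ badSet (x1Fun * f)⁻¹) :
    badSet (x1Fun * f) = badSet f := by
  ext ⟨a, n⟩
  refine and_congr_right fun _ => ⟨fun h' b m hc => ?_, fun h' c k hc => ?_⟩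
  · obtain ⟨c, k, hck, -⟩ := hc.x1Fun_mul
    exact h' _ _ hck
  · obtain ⟨b, m, hb⟩ := hc.of_x1Fun_mul (by
      rintro ⟨rfl, rfl⟩
      exact (mem_badSet_inv.mp h).2 _ _ hc)
    exact h' _ _ hb

/-- This is the case in which the new top caret survives. It accounts for the `+ 1`, and only the
space at height `1` can change weight. -/
theorem mapLength_x1Fun_mul_add (hf : IsPL2 f) (h : ((0 : ℝ), 0) ∈ badSet (x1Fun * f)⁻¹)
    (ht : f t = 1) :
    mapLength (x1Fun * f) + pointWeight f t = mapLength f + pointWeight (x1Fun * f) t + 1 := by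
  have hB := badSet_x1Fun_mul_of_mem h
  have hlab : ∀ s, pointLabel (x1Fun * f) s = pointLabel f s := fun s => by
    unfold pointLabel IsNecessary
    rw [hB]
  have := finsum_add_eq_of_eq_off (isPL2_x1Fun.mul hf).finite_support_pointWeight
    hf.finite_support_pointWeight (t := t) fun s hs => by
      have hs1 : f s ≠ 1 := fun h => hs (f.injective (h.trans ht.symm))
      exact pointWeight_congr leftTrivial_x1Fun_mul (rightTrivial_x1Fun_mul hs1)
        (by rw [pointLabel_x1Fun_mul_inv hs1, hlab])
  have hcard : (badSet (x1Fun * f)⁻¹).ncard = (badSet f⁻¹).ncard + 1 := by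
    have : badSet (x1Fun * f)⁻¹ = insert (0, 0) (x1Map '' badSet f⁻¹) := by
      ext q
      by_cases hq : q = (0, 0)
      · subst hq
        exact iff_of_true h (Set.mem_insert _ _)
      · rw [mem_badSet_x1Fun_mul_inv hq, Set.mem_insert_iff]
        tauto
    rw [this, Set.ncard_insert_of_notMem (zero_notMem_x1Map_image f)
      (hf.inv.finite_badSet.image _), Set.ncard_image_of_injective _ x1Map_injective]
  rw [mapLength, mapLength, hB, hcard]
  omega

/-- Rows R and I of the table agree outside column R, where they are `2` and `0`; this entry is the
second alternative. -/
theorem pointWeight_x1Fun_mul_cases (h : ((0 : ℝ), 0) ∈ badSet (x1Fun * f)⁻¹) (ht : f t = 1) :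
    pointWeight (x1Fun * f) t = pointWeight f t ∨
      (pointWeight (x1Fun * f) t = 0 ∧ pointWeight f t = 2 ∧ pointLabel f⁻¹ 1 = .R ∧
        pointLabel f t = .R ∧ ¬ RightTrivial f t) := by
  have hlab : pointLabel (x1Fun * f) t = pointLabel f t := by
    unfold pointLabel IsNecessary
    rw [badSet_x1Fun_mul_of_mem h]
  rw [pointWeight_x1Fun_mul_of_eq_one ht, hlab]
  by_cases hr : RightTrivial f t
  · left
    have h1 := hr.pointLabel_inv_eq
    rw [ht] at h1
    rw [pointWeight_of_rightTrivial hr, hr.pointLabel_eq]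
    rcases pointLabel_x1Fun_mul_inv_half (f := f) with ⟨h2, h3⟩ | ⟨h2, h3⟩
    · rw [h1] at h2
      cases h2
    · rw [h3]
      simp [weight]
  · rw [pointWeight_of_apply_eq_one ht hr]
    rcases pointLabel_x1Fun_mul_inv_half (f := f) with ⟨h2, h3⟩ | ⟨h2, h3⟩ <;> rw [h2, h3] <;>
      cases pointLabel f t <;> simp [weight, hr]

/-- `f` maps the interval `(a, n)` linearly onto `[0, 2]`, so it is a bottom caret. The new top
caret opposes it and both cancel: one bottom caret is lost, the number of top carets stays the same.
-/
theorem mapLength_x1Fun_mul_of_corr (hf : IsPL2 f) {a : ℝ} {n : ℕ}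
    (h : Corr (x1Fun * f) a n 0 0) : mapLength f = mapLength (x1Fun * f) + 1 := by
  have hbad : badSet f = insert (a, n) (badSet (x1Fun * f)) := by
    ext ⟨a', n'⟩
    rw [Set.mem_insert_iff]
    constructor
    · rintro ⟨hs, h'⟩
      by_cases hc : ∃ c k, Corr (x1Fun * f) a' n' c k
      · obtain ⟨c, k, hc⟩ := hc
        left
        by_cases h0 : c = 0 ∧ k = 0
        · obtain ⟨rfl, rfl⟩ := h0
          obtain ⟨h1, h2⟩ := hc.symm.unique h.symm
          rw [h1, h2]
        · obtain ⟨b, m, hb⟩ := hc.of_x1Fun_mul h0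
          exact absurd hb (h' _ _)
      · push Not at hc
        exact Or.inr ⟨hs, hc⟩
    · rintro (h' | ⟨hs, h'⟩)
      · simp only [Prod.mk.injEq] at h'
        obtain ⟨rfl, rfl⟩ := h'
        refine ⟨h.left, fun b m hb => ?_⟩
        obtain ⟨c, k, hc, hne⟩ := hb.x1Fun_mul
        obtain ⟨rfl, rfl⟩ := hc.unique h
        exact hne ⟨rfl, rfl⟩
      · refine ⟨hs, fun b m hb => ?_⟩
        obtain ⟨c, k, hc, -⟩ := hb.x1Fun_mul
        exact h' _ _ hc
  have hcard : (badSet f).ncard = (badSet (x1Fun * f)).ncard + 1 := by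
    rw [hbad, Set.ncard_insert_of_notMem h.notMem_badSet (isPL2_x1Fun.mul hf).finite_badSet]
  have hcard' : (badSet (x1Fun * f)⁻¹).ncard = (badSet f⁻¹).ncard := by
    have : badSet (x1Fun * f)⁻¹ = x1Map '' badSet f⁻¹ := by
      ext q
      by_cases hq : q = (0, 0)
      · subst hq
        exact iff_of_false h.symm.notMem_badSet (zero_notMem_x1Map_image f)
      · exact mem_badSet_x1Fun_mul_inv hq
    rw [this, Set.ncard_image_of_injective _ x1Map_injective]
  have hfa : f a = 0 :=
    x1Fun.injective (h.apply_left.trans (x1Fun_of_nonpos le_rfl).symm)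
  have hhalf : ∀ {b : ℝ} {m : ℕ}, IsStd b m → b + (1 / 2) * (1 / 2) ^ m = b + (1 / 2) ^ (m + 1) :=
    fun _ => by rw [pow_succ']
  obtain ⟨b, m, hmid⟩ := h.sub (a' := a + (1 / 2) ^ (n + 1)) (n' := n + 1)
    ((h.left.mono n.le_succ).add (isStd_width _)) n.le_succ (by simp)
    (by linarith [width_lt (Nat.lt_add_one n)])
  have hft : f (a + (1 / 2) ^ (n + 1)) = 1 := by
    have h1 := h.map (1 / 2) (by norm_num)
    rw [hhalf h.left, RelIso.mul_apply] at h1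
    exact x1Fun.injective (h1.trans (by rw [x1Fun_one]; norm_num))
  have hwt : ∀ s, pointWeight f s = pointWeight (x1Fun * f) s := by
    intro s
    by_cases hs1 : f s = 1
    -- The space under the cancelled caret has labels (R, I) before and (I, I) after, both of weight
    -- `0`.
    · obtain rfl : s = a + (1 / 2) ^ (n + 1) := f.injective (hs1.trans hft.symm)
      have hns : ¬ IsStd (a + (1 / 2) ^ (n + 1)) 0 := fun h' => by
        have := h.left.lt_of_mid h'
        omega
      have hN : ¬ IsNecessary (x1Fun * f) (a + (1 / 2) ^ (n + 1)) :=
        hmid.not_isNecessary fun k hk => h.left.lt_of_mid hk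
      have hN' : ¬ IsNecessary f (a + (1 / 2) ^ (n + 1)) := by
        rintro ⟨k, hk⟩
        rw [hbad, Set.mem_insert_iff] at hk
        rcases hk with hk | hk
        · simp at hk
        · exact hN ⟨k, hk⟩
      rw [pointWeight_x1Fun_mul_of_eq_one hs1, pointWeight_of_apply_eq_one hs1
        (fun h' => hns h'.isStd), pointLabel_eq_I hns hN, pointLabel_eq_I hns hN']
      have hhn : pointLabel (x1Fun * f)⁻¹ (1 / 2) = .I := by
        refine pointLabel_eq_I not_isStd_half ?_
        obtain ⟨b', m', h'⟩ := h.symm.sub (a' := 1 / 2) (n' := 1)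
          ((isStd_half_iff (n := 0)).mpr (isStd_one 0)) (Nat.zero_le 1) (by norm_num) (by norm_num)
        refine h'.not_isNecessary fun k hk => ?_
        by_contra! hc
        obtain rfl : k = 0 := by omega
        exact not_isStd_half hk
      rcases pointLabel_x1Fun_mul_inv_half (f := f) with ⟨h2, h3⟩ | ⟨h2, h3⟩
      · rw [hhn] at h3
        cases h3
      · rw [h2, h3]
        rfl
    refine pointWeight_congr leftTrivial_x1Fun_mul.symm (rightTrivial_x1Fun_mul hs1).symm ?_
    rw [pointLabel_x1Fun_mul_inv hs1]
    by_cases hs : s = a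
    · subst hs
      -- The bottom label at `a` may cease to be N, but the top label is L, and row L only tells
      -- column L from the others.
      rw [hfa, pointLabel_eq_L (isStd_zero 0) le_rfl]
      by_cases hL : IsStd s 0 ∧ s ≤ 0
      · rw [pointLabel_eq_L hL.1 hL.2, pointLabel_eq_L hL.1 hL.2]
      · have h1 := pointLabel_ne_L (f := f) hL
        have h2 := pointLabel_ne_L (f := x1Fun * f) hL
        revert h1 h2
        cases pointLabel f s <;> cases pointLabel (x1Fun * f) s <;> simp [weight]
    · congr 1
      refine pointLabel_congr Iff.rfl (fun _ => Iff.rfl) fun _ => exists_congr fun k => ?_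
      rw [hbad, Set.mem_insert_iff, Prod.mk.injEq]
      tauto
  rw [mapLength, mapLength, hcard, hcard', finsum_congr hwt]
  ring

theorem mapLength_x1Fun_mul (hf : IsPL2 f) :
    mapLength (x1Fun * f) = mapLength f + 1 ∨ mapLength f = mapLength (x1Fun * f) + 1 := by
  by_cases h : ((0 : ℝ), 0) ∈ badSet (x1Fun * f)⁻¹
  · obtain ⟨t, ht⟩ := f.surjective 1
    have h1 := mapLength_x1Fun_mul_add hf h ht
    rcases pointWeight_x1Fun_mul_cases h ht with h2 | ⟨h2, h3, -⟩ <;> omega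
  · obtain ⟨a, n, h'⟩ := exists_corr_of_notMem_badSet (isStd_zero 0) h
    exact Or.inr (mapLength_x1Fun_mul_of_corr hf (corr_inv_iff.mp h'))

end x1

/-! ### Every nontrivial element can be shortened by a generator -/

section descent

variable {f : ℝ ≃o ℝ} {t : ℝ} {n : ℕ}

theorem pointWeight_le (f : ℝ ≃o ℝ) (t : ℝ) :
    pointWeight f t ≤ weight (pointLabel f⁻¹ (f t)) (pointLabel f t) := by
  unfold pointWeight
  split_ifs
  · exact Nat.zero_le _
  · exact le_rfl

theorem x0Fun_inv_mul_apply_of_eq_zero (ht : f t = 0) : (x0Fun⁻¹ * f) t = 1 := by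
  have : (x0Fun * (x0Fun⁻¹ * f)) t = 0 := by rwa [mul_inv_cancel_left]
  rw [RelIso.mul_apply, x0Fun_apply] at this
  linarith

theorem mapLength_x0Fun_mul_lt (hf : IsPL2 f) (ht : f t = 1)
    (h : pointWeight (x0Fun * f) t < pointWeight f t) :
    mapLength (x0Fun * f) < mapLength f := by
  have := mapLength_x0Fun_mul_add hf ht
  omega

theorem mapLength_x0Fun_inv_mul_lt (hf : IsPL2 f) (ht : f t = 0)
    (h : pointWeight (x0Fun⁻¹ * f) t < pointWeight f t) :
    mapLength (x0Fun⁻¹ * f) < mapLength f := by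
  have := mapLength_x0Fun_mul_add (isPL2_x0Fun.inv.mul hf) (x0Fun_inv_mul_apply_of_eq_zero ht)
  rw [mul_inv_cancel_left] at this
  omega

theorem pointWeight_x0Fun_mul_le (ht : f t = 1) :
    pointWeight (x0Fun * f) t ≤ weight .L (pointLabel f t) := by
  refine (pointWeight_le _ _).trans_eq ?_
  rw [x0Fun_mul_apply_of_eq_one ht, pointLabel_eq_L (isStd_zero 0) le_rfl, pointLabel_x0Fun_mul]

/-- In column N the entries of rows N and R are `2`, that of row L is `1`. -/
theorem mapLength_x0Fun_mul_lt_of_label_N (hf : IsPL2 f) (ht : f t = 1)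
    (h : pointLabel f t = .N) : mapLength (x0Fun * f) < mapLength f := by
  refine mapLength_x0Fun_mul_lt hf ht ((pointWeight_x0Fun_mul_le ht).trans_lt ?_)
  rw [pointWeight_of_apply_eq_one ht fun h' => by simp [h'.pointLabel_eq] at h, h]
  rcases pointLabel_one f⁻¹ with h' | h' <;> simp [h', weight]

theorem mapLength_x0Fun_mul_lt_of_pos (hf : IsPL2 f) (ht : f t = 1) (hs : IsStd t 0) (h0 : 0 < t)
    (hr : ¬ RightTrivial f t) : mapLength (x0Fun * f) < mapLength f := by
  by_cases hN : IsNecessary f t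
  · exact mapLength_x0Fun_mul_lt_of_label_N hf ht
      (pointLabel_eq_N (fun h => not_lt.mpr h.2 h0) hN)
  · refine mapLength_x0Fun_mul_lt hf ht ((pointWeight_x0Fun_mul_le ht).trans_lt ?_)
    rw [pointWeight_of_apply_eq_one ht hr, pointLabel_eq_R hs h0 hN]
    rcases pointLabel_one f⁻¹ with h' | h' <;> simp [h', weight]

theorem mapLength_x0Fun_mul_lt_of_leftTrivial (hf : IsPL2 f) (ht : f t = 1)
    (h : LeftTrivial (x0Fun * f) t) : mapLength (x0Fun * f) < mapLength f := by
  refine mapLength_x0Fun_mul_lt hf ht ?_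
  rw [pointWeight_of_leftTrivial h, pointWeight_of_apply_eq_one ht
    (fun h' => absurd h.nonpos (not_le.mpr h'.pos)), pointLabel_eq_L h.isStd h.nonpos]
  rcases pointLabel_one f⁻¹ with h' | h' <;> simp [h', weight]

theorem mapLength_x0Fun_mul_lt_of_label_I (hf : IsPL2 f) (ht : f t = 1)
    (h : pointLabel f t = .I) (hN : IsNecessary f⁻¹ 1) :
    mapLength (x0Fun * f) < mapLength f := by
  refine mapLength_x0Fun_mul_lt hf ht ((pointWeight_x0Fun_mul_le ht).trans_lt ?_)
  rw [pointWeight_of_apply_eq_one ht fun h' => by simp [h'.pointLabel_eq] at h, h,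
    pointLabel_eq_N (fun h' => by linarith [h'.2]) hN]
  simp [weight]

theorem pointLabel_x0Fun_inv_mul (f : ℝ ≃o ℝ) (t : ℝ) :
    pointLabel (x0Fun⁻¹ * f) t = pointLabel f t := by
  rw [← pointLabel_x0Fun_mul, mul_inv_cancel_left]

theorem pointWeight_x0Fun_inv_mul_le (ht : f t = 0) :
    pointWeight (x0Fun⁻¹ * f) t ≤ weight (pointLabel (x0Fun⁻¹ * f)⁻¹ 1) (pointLabel f t) := by
  refine (pointWeight_le _ _).trans_eq ?_
  rw [x0Fun_inv_mul_apply_of_eq_zero ht, pointLabel_x0Fun_inv_mul]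

theorem mapLength_x0Fun_inv_mul_lt_of_label_I (hf : IsPL2 f) (ht : f t = 0)
    (h : pointLabel f t = .I) (hN : ¬ IsNecessary f⁻¹ 0) :
    mapLength (x0Fun⁻¹ * f) < mapLength f := by
  refine mapLength_x0Fun_inv_mul_lt hf ht ((pointWeight_x0Fun_inv_mul_le ht).trans_lt ?_)
  have hN' : ¬ IsNecessary (x0Fun⁻¹ * f)⁻¹ 1 := by
    rintro ⟨k, hk⟩
    refine hN ⟨k, ?_⟩
    rw [← mem_badSet_x0Fun_mul_inv, mul_inv_cancel_left] at hk
    simpa using hk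
  rw [pointWeight_of_apply_eq_zero ht fun h' => by
      simp [pointLabel_eq_L h'.isStd h'.nonpos] at h, h,
    pointLabel_eq_R (isStd_one 0) one_pos hN']
  simp [weight]

theorem mapLength_x0Fun_inv_mul_lt_of_nonpos (hf : IsPL2 f) (ht : f t = 0) (hs : IsStd t 0)
    (h0 : t ≤ 0) (hl : ¬ LeftTrivial f t) : mapLength (x0Fun⁻¹ * f) < mapLength f := by
  refine mapLength_x0Fun_inv_mul_lt hf ht ((pointWeight_x0Fun_inv_mul_le ht).trans_lt ?_)
  rw [pointWeight_of_apply_eq_zero ht hl, pointLabel_eq_L hs h0]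
  rcases pointLabel_one (x0Fun⁻¹ * f)⁻¹ with h' | h' <;> rw [h'] <;> simp [weight]

theorem mapLength_x0Fun_inv_mul_lt_of_rightTrivial (hf : IsPL2 f) (ht : f t = 0)
    (h : RightTrivial (x0Fun⁻¹ * f) t) : mapLength (x0Fun⁻¹ * f) < mapLength f := by
  refine mapLength_x0Fun_inv_mul_lt hf ht ?_
  rw [pointWeight_of_rightTrivial h, pointWeight_of_apply_eq_zero ht
    (fun h' => absurd h'.nonpos (not_le.mpr h.pos)), ← pointLabel_x0Fun_inv_mul, h.pointLabel_eq]
  simp [weight]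

/-- Two adjacent correspondences with intervals of the same width make up one linear piece. -/
theorem Corr.glue {a : ℝ} {n : ℕ} (ha : IsStd a n) (h1 : Corr f a (n + 1) 0 0)
    (h2 : Corr f (a + (1 / 2) ^ (n + 1)) (n + 1) 1 0) : Corr (x1Fun * f) a n 0 0 := by
  refine ⟨ha, isStd_zero 0, fun s hs => ?_⟩
  rw [RelIso.mul_apply]
  rcases le_total s (1 / 2) with h | h
  · have := h1.map (2 * s) ⟨by linarith [hs.1], by linarith⟩
    rw [width_succ] at this
    rw [show a + s * (1 / 2) ^ n = a + 2 * s * ((1 / 2) ^ n / 2) by ring, this,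
      x1Fun_of_mem (by simp; linarith [hs.1]) (by simp; linarith)]
    simp
  · have := h2.map (2 * s - 1) ⟨by linarith, by linarith [hs.2]⟩
    rw [width_succ] at this
    rw [show a + s * (1 / 2) ^ n = a + (1 / 2) ^ n / 2 + (2 * s - 1) * ((1 / 2) ^ n / 2) by ring,
      this, x1Fun_of_mem (by simp; linarith) (by simp; linarith [hs.2])]
    simp

/-- Two correspondences with the same left endpoints, one with the wider source and one with the
wider target, have the same target. -/
theorem Corr.of_corr_of_corr {a b : ℝ} {n m k l : ℕ} (h1 : Corr f a n b m) (h2 : Corr f a k b l)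
    (hkn : n ≤ k) (hml : l ≤ m) : Corr f a n b l := by
  have h3 := h1.apply_right
  have h4 := h2.apply_right
  have h5 := width_le hkn
  have h6 := width_le hml
  -- Monotonicity gives `2⁻ˡ ≤ 2⁻ᵐ`, and `hml` the reverse.
  have h7 := f.monotone (add_le_add_right h5 a)
  have : (1 / 2 : ℝ) ^ m = (1 / 2) ^ l := by linarith
  rwa [← width_inj this]

theorem rightTrivial_of_corr {c : ℝ} (hs : IsStd t 0) (h0 : 0 < t) (h : Corr f t 0 c 0)
    (hc : 0 < c) (htr : ∀ s ≥ t + 1, f s = s + (c - t)) : RightTrivial f t := by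
  refine ⟨hs, h.apply_left ▸ h.right, h0, h.apply_left ▸ hc, fun s hs' => ?_⟩
  rw [h.apply_left]
  rcases le_total (t + 1) s with h1 | h1
  · exact htr s h1
  · have := h.map (s - t) ⟨by linarith, by linarith⟩
    simp only [pow_zero, mul_one] at this
    rw [show t + (s - t) = s by ring] at this
    rw [this]
    ring

/-- The map is one of the generators of `F` or the inverse of one. -/
def IsGenerator (g : ℝ ≃o ℝ) : Prop :=
  (g = x0Fun ∨ g = x1Fun) ∨ g⁻¹ = x0Fun ∨ g⁻¹ = x1Fun

theorem exists_generator_of_mem_badSet (hf : IsPL2 f) (h : ((0 : ℝ), 0) ∈ badSet f⁻¹) :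
    ∃ g, IsGenerator g ∧ mapLength (g * f) < mapLength f := by
  -- `g` is `f` with the root of the top tree at the pointer removed.
  obtain ⟨g, rfl⟩ : ∃ g, f = x1Fun * g := ⟨x1Fun⁻¹ * f, by rw [mul_inv_cancel_left]⟩
  have hg : IsPL2 g := by simpa using isPL2_x1Fun.inv.mul hf
  obtain ⟨t, ht⟩ := g.surjective 1
  have hlen := mapLength_x1Fun_mul_add hg h ht
  rcases pointWeight_x1Fun_mul_cases h ht with h1 | ⟨-, -, h3, h4, h5⟩
  · refine ⟨x1Fun⁻¹, Or.inr (Or.inr (inv_inv _)), ?_⟩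
    rw [inv_mul_cancel_left]
    omega
  -- Here removing the root would turn a space of weight `0` into one of weight `2`. Moving the
  -- pointer right, past the space at `t + 1`, gains one instead.
  refine ⟨x0Fun, Or.inl (Or.inl rfl), ?_⟩
  have hnL : ¬ (IsStd t 0 ∧ t ≤ 0) := fun h' => by
    rw [pointLabel_eq_L h'.1 h'.2] at h4
    cases h4
  have hnN : ¬ IsNecessary g t := fun h' => by
    rw [pointLabel_eq_N hnL h'] at h4
    cases h4
  have hst : IsStd t 0 := by
    by_contra h'
    rw [pointLabel_eq_I h' hnN] at h4
    cases h4
  have h0 : 0 < t := by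
    by_contra! h'
    exact hnL ⟨hst, h'⟩
  have hnN' : ¬ IsNecessary g⁻¹ 1 := fun h' => by
    rw [pointLabel_eq_N (fun h' => by linarith [h'.2]) h'] at h3
    cases h3
  obtain ⟨m, hm⟩ := exists_corr_of_not_isNecessary hst hnN
  obtain ⟨k, hk⟩ := exists_corr_of_not_isNecessary (isStd_one 0) hnN'
  rw [← ht, RelIso.inv_apply_self] at hk
  -- As neither label is N, `[t, t + 1]` is mapped onto a standard interval and some standard
  -- interval at `t` is mapped onto `[1, 2]`. The two comparisons force `[t, t + 1]` to go onto `[1,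
  -- 2]`.
  have hc := hm.of_corr_of_corr (corr_inv_iff.mp hk) (Nat.zero_le _) (Nat.zero_le _)
  rw [ht] at hc
  have hr := hc.apply_right
  rw [pow_zero] at hr
  have hr' : (x1Fun * g) (t + 1) = 1 := by
    rw [RelIso.mul_apply, hr, x1Fun_of_two_le (by norm_num)]
    norm_num
  refine mapLength_x0Fun_mul_lt_of_pos hf hr' (hst.add (isStd_one 0)) (by linarith) fun hR => h5 ?_
  refine rightTrivial_of_corr hst h0 hc one_pos fun s hs => ?_
  have h6 := hR.apply_eq s hs
  have h7 : 2 ≤ g s := by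
    refine le_trans ?_ (g.monotone hs)
    rw [hr]
    norm_num
  rw [hr', RelIso.mul_apply, x1Fun_of_two_le h7] at h6
  linarith

/-- The top tree at the pointer and the bottom tree over it, `[t, t + 1]`, are both trivial. If `t ≤
0`, the pointer moves left unless everything there is trivial, in which case it moves right; for `t
> 0` it moves right unless everything there is trivial, in which case it moves left. -/
theorem exists_generator_of_corr_unit (hf : IsPL2 f) (hne : f ≠ 1) (h : Corr f t 0 0 0) :
    ∃ g, IsGenerator g ∧ mapLength (g * f) < mapLength f := by
  have hr := h.apply_right
  simp only [pow_zero, zero_add] at hr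
  have hs' : IsStd (t + 1) 0 := h.left.add (isStd_one 0)
  rcases le_or_gt t 0 with ht | ht
  · by_cases hL : LeftTrivial f t
    swap
    · exact ⟨x0Fun⁻¹, Or.inr (Or.inl (inv_inv _)),
        mapLength_x0Fun_inv_mul_lt_of_nonpos hf h.apply_left h.left ht hL⟩
    have htr : ∀ s ≤ t + 1, f s = s - t := by
      intro s hs
      rcases le_total s t with h1 | h1
      · rw [hL.apply_eq s h1, h.apply_left]; ring
      · have := h.map (s - t) ⟨by linarith, by linarith⟩
        simp only [pow_zero, mul_one] at this
        rw [show t + (s - t) = s by ring] at this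
        rw [this, zero_add]
    refine ⟨x0Fun, Or.inl (Or.inl rfl), ?_⟩
    rcases le_or_gt (t + 1) 0 with ht' | ht'
    · refine mapLength_x0Fun_mul_lt_of_leftTrivial hf hr ?_
      have h0 := x0Fun_mul_apply_of_eq_one hr
      refine ⟨hs', h0 ▸ isStd_zero 0, ht', h0.le, fun s hs => ?_⟩
      rw [h0, RelIso.mul_apply, x0Fun_apply, htr s hs]
      ring
    -- Now `t = 0`; triviality on both sides would make `f` the identity.
    · refine mapLength_x0Fun_mul_lt_of_pos hf hr hs' ht' fun hR => hne ?_
      have ht0 : t = 0 := by linarith [hs'.one_le ht']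
      subst ht0
      ext s
      rcases le_total s (0 + 1) with h1 | h1
      · rw [htr s h1]; simp
      · rw [hR.apply_eq s h1, hr]; simp
  · by_cases hR : RightTrivial f (t + 1)
    swap
    · exact ⟨x0Fun, Or.inl (Or.inl rfl),
        mapLength_x0Fun_mul_lt_of_pos hf hr hs' (by linarith) hR⟩
    refine ⟨x0Fun⁻¹, Or.inr (Or.inl (inv_inv _)),
      mapLength_x0Fun_inv_mul_lt_of_rightTrivial hf h.apply_left ?_⟩
    have hx : Corr x0Fun 1 0 0 0 := by simpa using corr_x0Fun (isStd_one 0)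
    refine rightTrivial_of_corr h.left ht (hx.symm.comp h) one_pos fun s hs => ?_
    have h1 : (x0Fun * (x0Fun⁻¹ * f)) s = s + (f (t + 1) - (t + 1)) := by
      rw [mul_inv_cancel_left, hR.apply_eq s hs]
    rw [RelIso.mul_apply, x0Fun_apply, hr] at h1
    linarith

/-- Consider the space at the right end of the left child. If its bottom or top label is N, moving
the pointer right lowers its weight from `2` to `1`. Otherwise the sibling is matched with `[1, 2]`,
and the caret added by `x₁` cancels the parent. -/
theorem exists_generator_of_left_child (hf : IsPL2 f) (hs : IsStd t n)
    (h : Corr f t (n + 1) 0 0) : ∃ g, IsGenerator g ∧ mapLength (g * f) < mapLength f := by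
  have hr := h.apply_right
  simp only [pow_zero, zero_add] at hr
  have hns : ¬ IsStd (t + (1 / 2) ^ (n + 1)) 0 := fun h' => by
    have := hs.lt_of_mid h'
    omega
  by_cases hN : IsNecessary f (t + (1 / 2) ^ (n + 1))
  · exact ⟨x0Fun, Or.inl (Or.inl rfl), mapLength_x0Fun_mul_lt_of_label_N hf hr
      (pointLabel_eq_N (fun h' => hns h'.1) hN)⟩
  by_cases hN' : IsNecessary f⁻¹ 1
  · exact ⟨x0Fun, Or.inl (Or.inl rfl), mapLength_x0Fun_mul_lt_of_label_I hf hr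
      (pointLabel_eq_I hns hN) hN'⟩
  refine ⟨x1Fun, Or.inl (Or.inr rfl), ?_⟩
  obtain ⟨m, hm⟩ := exists_corr_of_not_isNecessary (h.left.add (isStd_width _)) hN
  obtain ⟨k, hk⟩ := exists_corr_of_not_isNecessary (isStd_one 0) hN'
  rw [← hr, RelIso.inv_apply_self] at hk
  have hc := hm.of_corr_of_corr (corr_inv_iff.mp hk) (hs.lt_of_mid hk.right) (Nat.zero_le _)
  rw [hr] at hc
  have := mapLength_x1Fun_mul_of_corr hf (Corr.glue hs h hc)
  omega

/-- At the left end of a right child the bottom label is I, since every standard interval starting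
there lies in that leaf. Moving the pointer left replaces the entry (L, I) `= 1` by (R, I) `= 0`. -/
theorem exists_generator_of_right_child (hf : IsPL2 f) (hs : ¬ IsStd t n)
    (h : Corr f t (n + 1) 0 0) : ∃ g, IsGenerator g ∧ mapLength (g * f) < mapLength f := by
  refine ⟨x0Fun⁻¹, Or.inr (Or.inl (inv_inv _)), mapLength_x0Fun_inv_mul_lt_of_label_I hf
    h.apply_left (pointLabel_eq_I (fun h' => hs (h'.mono (Nat.zero_le n))) ?_) ?_⟩
  · refine h.not_isNecessary fun k hk => ?_
    by_contra! hc
    exact hs (hk.mono (by omega))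
  · exact h.symm.not_isNecessary fun _ _ => Nat.zero_le _

theorem exists_generator_mapLength_lt (hf : IsPL2 f) (hne : f ≠ 1) :
    ∃ g, IsGenerator g ∧ mapLength (g * f) < mapLength f := by
  by_cases h : ((0 : ℝ), 0) ∈ badSet f⁻¹
  · exact exists_generator_of_mem_badSet hf h
  obtain ⟨t, n, hc⟩ := exists_corr_of_notMem_badSet (isStd_zero 0) h
  rw [corr_inv_iff] at hc
  cases n with
  | zero => exact exists_generator_of_corr_unit hf hne hc
  | succ n =>
    by_cases hs : IsStd t n
    · exact exists_generator_of_left_child hf hs hc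
    · exact exists_generator_of_right_child hf hs hc

end descent

/-! ### The length of a map is its word length -/

theorem IsGenerator.isPL2 {g : ℝ ≃o ℝ} (hg : IsGenerator g) : IsPL2 g := by
  rcases hg with (rfl | rfl) | h | h
  · exact isPL2_x0Fun
  · exact isPL2_x1Fun
  · rw [← inv_inv g, h]; exact isPL2_x0Fun.inv
  · rw [← inv_inv g, h]; exact isPL2_x1Fun.inv

theorem IsGenerator.mapLength_mul {f g : ℝ ≃o ℝ} (hg : IsGenerator g) (hf : IsPL2 f) :
    mapLength (g * f) = mapLength f + 1 ∨ mapLength f = mapLength (g * f) + 1 := by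
  have hgf := hg.isPL2.mul hf
  rcases hg with (rfl | rfl) | h | h
  · exact mapLength_x0Fun_mul hf
  · exact mapLength_x1Fun_mul hf
  · have := mapLength_x0Fun_mul hgf
    rw [← h, inv_mul_cancel_left] at this
    exact this.symm
  · have := mapLength_x1Fun_mul hgf
    rw [← h, inv_mul_cancel_left] at this
    exact this.symm

theorem corr_one {a : ℝ} {n : ℕ} (h : IsStd a n) : Corr 1 a n a n := ⟨h, h, fun _ _ => rfl⟩

theorem mapLength_one : mapLength 1 = 0 := by
  have hb : badSet 1 = ∅ := Set.eq_empty_of_forall_notMem fun q hq => hq.2 _ _ (corr_one hq.1)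
  have hN : ∀ t, ¬ IsNecessary 1 t := by
    rintro t ⟨n, hn⟩
    rw [hb] at hn
    exact hn
  have hw : ∀ t, pointWeight 1 t = 0 := by
    intro t
    by_cases hs : IsStd t 0
    · rcases le_or_gt t 0 with h | h
      · exact pointWeight_of_leftTrivial ⟨hs, hs, h, h, fun s _ => by simp⟩
      · exact pointWeight_of_rightTrivial ⟨hs, hs, h, h, fun s _ => by simp⟩
    · refine Nat.le_zero.mp ((pointWeight_le _ _).trans_eq ?_)
      rw [inv_one, RelIso.one_apply, pointLabel_eq_I hs (hN t)]
      rfl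
  rw [mapLength, inv_one, hb, Set.ncard_empty, finsum_congr hw, finsum_zero, add_zero]

theorem isGenerator_iff (s : F) :
    (s ∈ ({x0, x1} : Set F) ∨ s⁻¹ ∈ ({x0, x1} : Set F)) ↔ IsGenerator (s : ℝ ≃o ℝ) := by
  simp only [Set.mem_insert_iff, Set.mem_singleton_iff, Subtype.ext_iff, x0, x1, IsGenerator,
    Subgroup.coe_inv]

theorem mapLength_prod_le (w : List F)
    (hw : ∀ s ∈ w, s ∈ ({x0, x1} : Set F) ∨ s⁻¹ ∈ ({x0, x1} : Set F)) :
    mapLength (w.prod : ℝ ≃o ℝ) ≤ w.length := by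
  induction w with
  | nil => simp [mapLength_one]
  | cons s w ih =>
    have h1 := ih fun s' hs' => hw s' (List.mem_cons_of_mem _ hs')
    have h2 := ((isGenerator_iff s).mp (hw s List.mem_cons_self)).mapLength_mul (w.prod).2
    rw [List.prod_cons, Subgroup.coe_mul, List.length_cons]
    omega

theorem mapLength_mem_wordLengths (f : F) :
    mapLength (f : ℝ ≃o ℝ) ∈ wordLengths {x0, x1} f := by
  induction hn : mapLength (f : ℝ ≃o ℝ) using Nat.strong_induction_on generalizing f with
  | _ n ih =>
    by_cases hf : (f : ℝ ≃o ℝ) = 1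
    · obtain rfl : f = 1 := Subtype.ext hf
      rw [← hn]
      exact ⟨[], by simp, rfl, by simp [mapLength_one]⟩
    obtain ⟨g, hg, hlt⟩ := exists_generator_mapLength_lt f.2 hf
    lift g to F using hg.isPL2
    have hlen := hg.mapLength_mul f.2
    obtain ⟨w, hw, hprod, hl⟩ := ih (mapLength (g * f : F)) (by rw [← hn]; exact hlt) (g * f) rfl
    refine ⟨g⁻¹ :: w, fun s hs => ?_, by rw [List.prod_cons, hprod, inv_mul_cancel_left], ?_⟩
    · rcases List.mem_cons.mp hs with rfl | hs
      · rw [inv_inv, or_comm]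
        exact (isGenerator_iff g).mpr hg
      · exact hw s hs
    · rw [List.length_cons, hl, Subgroup.coe_mul]
      omega

theorem isLeast_wordLengths (f : F) :
    IsLeast (wordLengths {x0, x1} f) (mapLength (f : ℝ ≃o ℝ)) := by
  refine ⟨mapLength_mem_wordLengths f, ?_⟩
  rintro n ⟨w, hw, rfl, rfl⟩
  exact mapLength_prod_le w hw

/-! ### Paths in binary trees -/

theorem IsCaretPath.not_isLeafPath {t : BinaryTree Unit} {p : List Bool} (h : IsCaretPath t p) :
    ¬ IsLeafPath t p := by
  induction t generalizing p with
  | nil => exact h.elim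
  | node a l r hl hr =>
    match p, h with
    | [], _ => exact id
    | false :: p, h => exact hl h
    | true :: p, h => exact hr h

theorem isCaretPath_or_exists_isLeafPath (t : BinaryTree Unit) (p : List Bool) :
    IsCaretPath t p ∨ ∃ q r, p = q ++ r ∧ IsLeafPath t q := by
  induction t generalizing p with
  | nil => exact Or.inr ⟨[], p, rfl, trivial⟩
  | node a l r hl hr =>
    match p with
    | [] => exact Or.inl trivial
    | false :: p =>
      exact (hl p).imp id fun ⟨q, s, h, h'⟩ => ⟨false :: q, s, by rw [h]; rfl, h'⟩
    | true :: p =>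
      exact (hr p).imp id fun ⟨q, s, h, h'⟩ => ⟨true :: q, s, by rw [h]; rfl, h'⟩

theorem IsLeafPath.eq_nil_of_append {t : BinaryTree Unit} {p r : List Bool} (h : IsLeafPath t p)
    (h' : IsLeafPath t (p ++ r)) : r = [] := by
  induction t generalizing p with
  | nil =>
    match p, r, h, h' with
    | [], [], _, _ => rfl
    | [], _ :: _, _, h' => exact h'.elim
    | _ :: _, _, h, _ => exact h.elim
  | node a l r hl hr =>
    match p, h, h' with
    | [], h, _ => exact h.elim
    | false :: p, h, h' => exact hl h h'
    | true :: p, h, h' => exact hr h h'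

theorem IsCaretPath.child {t : BinaryTree Unit} {p : List Bool} (h : IsCaretPath t p) (b : Bool) :
    IsCaretPath t (p ++ [b]) ∨ IsLeafPath t (p ++ [b]) := by
  induction t generalizing p with
  | nil => exact h.elim
  | node a l r hl hr =>
    match p, h with
    | [], _ =>
      cases b
      · cases l
        · exact Or.inr trivial
        · exact Or.inl trivial
      · cases r
        · exact Or.inr trivial
        · exact Or.inl trivial
    | false :: p, h => exact hl h
    | true :: p, h => exact hr h

theorem IsLeafPath.isCaretPath_of_append {t : BinaryTree Unit} {p : List Bool} {b : Bool}
    (h : IsLeafPath t (p ++ [b])) : IsCaretPath t p := by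
  induction t generalizing p with
  | nil => cases p <;> exact h.elim
  | node a l r hl hr =>
    match p, h with
    | [], _ => trivial
    | false :: p, h => exact hl h
    | true :: p, h => exact hr h

theorem exists_isLeafPath_replicate (t : BinaryTree Unit) :
    ∃ k, IsLeafPath t (List.replicate k false) := by
  induction t with
  | nil => exact ⟨0, trivial⟩
  | node a l r hl _ =>
    obtain ⟨k, hk⟩ := hl
    exact ⟨k + 1, hk⟩

theorem IsCaretPath.exists_leftmost {t : BinaryTree Unit} {p : List Bool} (h : IsCaretPath t p) :
    ∃ k, IsLeafPath t (p ++ List.replicate k false) := by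
  induction t generalizing p with
  | nil => exact h.elim
  | node a l r hl hr =>
    match p, h with
    | [], _ => exact exists_isLeafPath_replicate _
    | false :: p, h => exact hl h
    | true :: p, h => exact hr h

theorem eq_of_isCaretPath_iff {t t' : BinaryTree Unit}
    (h : ∀ p, IsCaretPath t p ↔ IsCaretPath t' p) : t = t' := by
  induction t generalizing t' with
  | nil =>
    cases t' with
    | nil => rfl
    | node => exact ((h []).mpr trivial).elim
  | node a l r hl hr =>
    cases t' with
    | nil => exact ((h []).mp trivial).elim
    | node a' l' r' =>
      rw [hl fun p => h (false :: p), hr fun p => h (true :: p)]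

theorem isCaretPath_nil_iff {t : BinaryTree Unit} : IsCaretPath t [] ↔ t ≠ .nil := by
  cases t <;> simp [IsCaretPath]

/-- The paths to the carets of a tree. -/
def caretFinset : BinaryTree Unit → Finset (List Bool)
  | .nil => ∅
  | .node _ l r => insert [] ((caretFinset l).image (List.cons false) ∪
      (caretFinset r).image (List.cons true))

theorem mem_caretFinset {t : BinaryTree Unit} {p : List Bool} :
    p ∈ caretFinset t ↔ IsCaretPath t p := by
  induction t generalizing p with
  | nil => simp [caretFinset, IsCaretPath]
  | node a l r hl hr =>
    match p with
    | [] => simp [caretFinset, IsCaretPath]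
    | false :: p => simp [caretFinset, IsCaretPath, hl]
    | true :: p => simp [caretFinset, IsCaretPath, hr]

theorem card_caretFinset (t : BinaryTree Unit) : (caretFinset t).card = t.numNodes := by
  induction t with
  | nil => rfl
  | node a l r hl hr =>
    rw [caretFinset, Finset.card_insert_of_notMem (by simp), Finset.card_union_of_disjoint,
      Finset.card_image_of_injective _ List.cons_injective,
      Finset.card_image_of_injective _ List.cons_injective, hl, hr, BinaryTree.numNodes]
    rw [Finset.disjoint_left]
    simp

/-! ### Vertices of forests as standard dyadic intervals -/

theorem pathStart_append (p q : List Bool) :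
    pathStart (p ++ q) = pathStart p + pathStart q * (1 / 2) ^ p.length := by
  induction p with
  | nil => simp [pathStart]
  | cons b p ih =>
    cases b <;> simp only [List.cons_append, pathStart, ih, List.length_cons, pow_succ] <;> ring

theorem pathStart_replicate (k : ℕ) : pathStart (List.replicate k false) = 0 := by
  induction k with
  | zero => rfl
  | succ k ih => simp [List.replicate_succ, pathStart, ih]

theorem isStd_pathStart (p : List Bool) : IsStd (pathStart p) p.length := by
  induction p with
  | nil => exact isStd_zero 0
  | cons b p ih =>
    cases b
    · exact isStd_half_iff.mpr ih
    · exact isStd_half_iff.mpr ((isStd_one _).add ih)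

theorem isStd_vertex (i : ℤ) (p : List Bool) : IsStd (i + pathStart p) p.length :=
  (isStd_intCast i _).add (isStd_pathStart p)

theorem pathStart_injective {p q : List Bool} (hl : p.length = q.length)
    (h : pathStart p = pathStart q) : p = q := by
  induction p generalizing q with
  | nil => exact (List.length_eq_zero_iff.mp hl.symm).symm
  | cons b p ih =>
    cases q with
    | nil => simp at hl
    | cons c q =>
      have hp := pathStart_mem p
      have hq := pathStart_mem q
      have hl' : p.length = q.length := by simpa using hl
      cases b <;> cases c <;> simp only [pathStart] at h
      · rw [ih hl' (by linarith)]
      · linarith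
      · linarith
      · rw [ih hl' (by linarith)]

theorem idx_eq_of_vertex_mem {i j : ℤ} {x : ℝ} (h1 : (i : ℝ) ≤ x) (h2 : x < i + 1)
    (h3 : (j : ℝ) ≤ x) (h4 : x < j + 1) : i = j := by
  have h5 : (i : ℝ) < j + 1 := by linarith
  have h6 : (j : ℝ) < i + 1 := by linarith
  have h7 : i < j + 1 := by exact_mod_cast h5
  have h8 : j < i + 1 := by exact_mod_cast h6
  omega

theorem vertex_injective {i j : ℤ} {p q : List Bool} (hl : p.length = q.length)
    (h : (i : ℝ) + pathStart p = j + pathStart q) : i = j ∧ p = q := by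
  have hp := pathStart_mem p
  have hq := pathStart_mem q
  have hij : i = j := idx_eq_of_vertex_mem (x := i + pathStart p) (by linarith) (by linarith)
    (by linarith) (by linarith)
  subst hij
  exact ⟨rfl, pathStart_injective hl (by linarith)⟩

theorem IsStd.eq_of_mem {a b x : ℝ} {n : ℕ} (ha : IsStd a n) (hb : IsStd b n) (h1 : a ≤ x)
    (h2 : x < a + (1 / 2) ^ n) (h3 : b ≤ x) (h4 : x < b + (1 / 2) ^ n) : a = b := by
  rcases lt_trichotomy a b with h | h | h
  · linarith [ha.add_le_of_lt hb h]
  · exact h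
  · linarith [hb.add_le_of_lt ha h]

/-- A point that is standard at depth `n + 1` is either standard at depth `n` or the midpoint of an
interval of depth `n`, which gives the last turn of the path. -/
theorem exists_vertex {a : ℝ} {n : ℕ} (h : IsStd a n) :
    ∃ (i : ℤ) (p : List Bool), p.length = n ∧ a = i + pathStart p := by
  induction n generalizing a with
  | zero =>
    obtain ⟨i, rfl⟩ := isStd_zero_right.mp h
    exact ⟨i, [], rfl, by simp [pathStart]⟩
  | succ n ih =>
    obtain ⟨a₀, h0, h1, h2⟩ := exists_isStd_floor a n
    obtain ⟨i, p, hp, rfl⟩ := ih h0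
    have hw := width_succ n
    rcases h1.eq_or_lt with h3 | h3
    · exact ⟨i, p ++ [false], by simp [hp], by simp [pathStart_append, pathStart, ← h3]⟩
    · refine ⟨i, p ++ [true], by simp [hp], ?_⟩
      have hle := (h0.mono (Nat.le_add_right n 1)).add_le_of_lt h h3
      have hge : a ≤ i + pathStart p + (1 / 2) ^ (n + 1) := by
        by_contra! hc
        have := ((h0.mono (Nat.le_add_right n 1)).add (isStd_width (n + 1))).add_le_of_lt h hc
        linarith
      rw [pathStart_append, hp]
      simp only [pathStart]
      linarith

theorem vertex_append (i : ℤ) (q r : List Bool) :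
    (i : ℝ) + pathStart q ≤ i + pathStart (q ++ r) ∧
      i + pathStart (q ++ r) < i + pathStart q + (1 / 2) ^ q.length := by
  have hr := pathStart_mem r
  have hp : (0 : ℝ) < (1 / 2) ^ q.length := by positivity
  rw [pathStart_append]
  constructor
  · nlinarith
  · nlinarith

namespace BinaryForest

variable {T : BinaryForest}

theorem Leaf.isStd_start (v : T.Leaf) : IsStd v.start v.path.length := isStd_vertex _ _

theorem Leaf.idx_le_start (v : T.Leaf) : (v.idx : ℝ) ≤ v.start := by
  have := (pathStart_mem v.path).1
  rw [Leaf.start]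
  linarith

theorem Leaf.start_lt_idx_add_one (v : T.Leaf) : v.start < v.idx + 1 := by
  have := (pathStart_mem v.path).2
  rw [Leaf.start]
  linarith

theorem Leaf.width_pos (v : T.Leaf) : 0 < v.width := by
  rw [Leaf.width]
  positivity

theorem Leaf.end_le_idx_add_one (v : T.Leaf) : v.start + v.width ≤ v.idx + 1 := by
  refine v.isStd_start.add_le_of_lt ?_ v.start_lt_idx_add_one
  exact_mod_cast isStd_intCast (v.idx + 1) v.path.length

theorem Leaf.lt_iff {u v : T.Leaf} : u < v ↔ u.start < v.start := Iff.rfl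

theorem Leaf.le_iff {u v : T.Leaf} : u ≤ v ↔ u.start ≤ v.start := Iff.rfl

theorem Leaf.ext {u v : T.Leaf} (h1 : u.idx = v.idx) (h2 : u.path = v.path) : u = v :=
  Subtype.ext (Prod.ext h1 h2)

/-- The intervals of different leaves are disjoint. -/
theorem Leaf.eq_of_mem {u v : T.Leaf} {x : ℝ} (hu : u.start ≤ x) (hu' : x < u.start + u.width)
    (hv : v.start ≤ x) (hv' : x < v.start + v.width) : u = v := by
  wlog hle : u.path.length ≤ v.path.length generalizing u v
  · exact (this hv hv' hu hu' (le_of_not_ge hle)).symm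
  -- The ancestor of `v` at the depth of `u` has the same interval as `u`, and no leaf lies properly
  -- below another.
  have hv0 : (v.idx : ℝ) + pathStart (v.path.take u.path.length ++ v.path.drop u.path.length) =
      v.start := by rw [List.take_append_drop]; rfl
  have hlen : (v.path.take u.path.length).length = u.path.length := by simp [hle]
  have happ := vertex_append v.idx (v.path.take u.path.length) (v.path.drop u.path.length)
  rw [hv0] at happ
  have hstd := isStd_vertex v.idx (v.path.take u.path.length)
  rw [hlen] at hstd happ
  have hend := v.isStd_start.add_le_of_lt
    ((hstd.add (isStd_width _)).mono hle) happ.2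
  have heq := u.isStd_start.eq_of_mem hstd hu hu' (happ.1.trans hv) (hv'.trans_le hend)
  obtain ⟨h1, h2⟩ := vertex_injective hlen.symm heq
  have hdrop : v.path.drop u.path.length = [] := by
    refine IsLeafPath.eq_nil_of_append (t := T.tree v.idx) (p := v.path.take u.path.length) ?_ ?_
    · rw [← h2, ← h1]
      exact u.2
    · rw [List.take_append_drop]
      exact v.2
  refine Leaf.ext h1 ?_
  rw [h2]
  conv_rhs => rw [← List.take_append_drop u.path.length v.path, hdrop, List.append_nil]

theorem Leaf.start_injective : Function.Injective (Leaf.start (T := T)) := fun u v h =>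
  Leaf.eq_of_mem (x := u.start) le_rfl (by linarith [u.width_pos]) h.ge (by linarith [v.width_pos])

theorem exists_leaf_of_not_isCaretPath {i : ℤ} {p : List Bool}
    (h : ¬ IsCaretPath (T.tree i) p) : ∃ (v : T.Leaf) (r : List Bool), v.idx = i ∧
      p = v.path ++ r := by
  obtain ⟨q, r, hqr, hq⟩ := (isCaretPath_or_exists_isLeafPath _ _).resolve_left h
  exact ⟨⟨(i, q), hq⟩, r, rfl, hqr⟩

/-- The carets of a forest. -/
def carets (T : BinaryForest) : Finset ((_ : ℤ) × List Bool) :=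
  T.bounded.toFinset.sigma fun i => caretFinset (T.tree i)

theorem mem_carets {i : ℤ} {p : List Bool} :
    (⟨i, p⟩ : (_ : ℤ) × List Bool) ∈ T.carets ↔ IsCaretPath (T.tree i) p := by
  simp only [carets, Finset.mem_sigma, Set.Finite.mem_toFinset, Set.mem_ofPred_eq, mem_caretFinset]
  refine and_iff_right_of_imp fun h h0 => ?_
  rw [h0] at h
  exact h

theorem card_carets (T : BinaryForest) : T.carets.card = T.numCarets := by
  simp only [carets, Finset.card_sigma, card_caretFinset, numCarets]

/-- The intervals of the leaves cover the line. -/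
theorem exists_leaf_mem (T : BinaryForest) (x : ℝ) :
    ∃ v : T.Leaf, v.start ≤ x ∧ x < v.start + v.width := by
  -- At a depth beyond all carets, the vertex around `x` must be at or below a leaf.
  obtain ⟨a, ha, h1, h2⟩ := exists_isStd_floor x (T.carets.sup (fun c => c.2.length) + 1)
  obtain ⟨i, p, hp, rfl⟩ := exists_vertex ha
  have hc : ¬ IsCaretPath (T.tree i) p := fun hc => by
    have := Finset.le_sup (f := fun c : (_ : ℤ) × List Bool => c.2.length) (mem_carets.mpr hc)
    simp only at this
    omega
  obtain ⟨v, r, rfl, rfl⟩ := exists_leaf_of_not_isCaretPath hc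
  have happ := vertex_append v.idx v.path r
  refine ⟨v, happ.1.trans h1, h2.trans_le ?_⟩
  rw [← hp] at ha ⊢
  exact ha.add_le_of_lt ((v.isStd_start.add (isStd_width _)).mono (by simp)) happ.2

theorem isInterior_iff {v : T.Leaf} : IsInterior v ↔ ¬ IsStd v.start 0 := by
  have hidx : IsStd (v.idx : ℝ) 0 := isStd_intCast _ _
  constructor
  · rintro ⟨u, hlt, hu⟩
    refine hidx.not_isStd_zero_of_mem ?_ v.start_lt_idx_add_one
    rw [← hu]
    exact u.idx_le_start.trans_lt (Leaf.lt_iff.mp hlt)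
  · intro h
    have hlt : (v.idx : ℝ) < v.start := lt_of_le_of_ne v.idx_le_start fun h' => h (h' ▸ hidx)
    obtain ⟨u, hu, hu'⟩ := T.exists_leaf_mem v.idx
    refine ⟨u, Leaf.lt_iff.mpr (hu.trans_lt hlt), ?_⟩
    exact idx_eq_of_vertex_mem (u.idx_le_start.trans hu) (hu'.trans_le u.end_le_idx_add_one) le_rfl
      (lt_add_one _)

/-! ### Forests determined by a map -/

/-- The carets of the forest are the vertices whose intervals are not mapped linearly onto standard
dyadic intervals by `f`. -/
def Adapted (T : BinaryForest) (f : ℝ ≃o ℝ) : Prop :=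
  ∀ i p, IsCaretPath (T.tree i) p ↔ ((i : ℝ) + pathStart p, p.length) ∈ badSet f

namespace Adapted

variable {f : ℝ ≃o ℝ}

theorem unique {T T' : BinaryForest} (h : T.Adapted f) (h' : T'.Adapted f) : T = T' := by
  obtain ⟨t, ht⟩ := T
  obtain ⟨t', ht'⟩ := T'
  obtain rfl : t = t' := funext fun i =>
    eq_of_isCaretPath_iff fun p => (h i p).trans (h' i p).symm
  rfl

theorem numCarets (h : T.Adapted f) : T.numCarets = (badSet f).ncard := by
  rw [← card_carets, ← Set.ncard_coe_finset]
  refine Set.ncard_congr (fun c _ => ((c.1 : ℝ) + pathStart c.2, c.2.length)) ?_ ?_ ?_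
  · rintro ⟨i, p⟩ hc
    exact (h i p).mp (mem_carets.mp hc)
  · rintro ⟨i, p⟩ ⟨j, q⟩ _ _ heq
    simp only [Prod.mk.injEq] at heq
    obtain ⟨rfl, rfl⟩ := vertex_injective heq.2 heq.1
    rfl
  · rintro ⟨a, n⟩ hb
    obtain ⟨i, p, rfl, rfl⟩ := exists_vertex hb.1
    exact ⟨⟨i, p⟩, mem_carets.mpr ((h i p).mpr hb), rfl⟩

theorem exists_corr (h : T.Adapted f) (v : T.Leaf) :
    ∃ b m, Corr f v.start v.path.length b m :=
  exists_corr_of_notMem_badSet v.isStd_start fun hb =>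
    ((h v.idx v.path).mpr hb).not_isLeafPath v.2

/-- A caret and the leftmost leaf below it have the same left endpoint. -/
theorem isLeftOfCaret_iff (h : T.Adapted f) {v : T.Leaf} :
    IsLeftOfCaret v ↔ IsNecessary f v.start := by
  constructor
  · rintro ⟨p, hp, k, hk⟩
    refine ⟨p.length, ?_⟩
    rw [Leaf.start, hk, pathStart_append, pathStart_replicate, zero_mul, add_zero]
    exact (h _ _).mp hp
  · rintro ⟨n, hn⟩
    obtain ⟨i, p, rfl, hp⟩ : ∃ (i : ℤ) (p : List Bool), p.length = n ∧ v.start = i + pathStart p :=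
      exists_vertex hn.1
    rw [hp, ← h] at hn
    obtain ⟨k, hk⟩ := hn.exists_leftmost
    have : v = ⟨(i, p ++ List.replicate k false), hk⟩ := by
      refine Leaf.start_injective (hp.trans ?_)
      simp [Leaf.start, Leaf.idx, Leaf.path, pathStart_append, pathStart_replicate]
    subst this
    exact ⟨p, hn, k, rfl⟩

theorem label_eq (h : T.Adapted f) (v : T.Leaf) : label v = pointLabel f v.start := by
  have hE : IsExterior v ↔ IsStd v.start 0 := by rw [IsExterior, isInterior_iff, not_not]
  have h0 : IsStd v.start 0 → (v.idx ≤ 0 ↔ v.start ≤ 0) := by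
    intro hs
    constructor
    · intro hi
      refine hs.nonpos_of_lt_one (v.start_lt_idx_add_one.trans_le ?_)
      have : (v.idx : ℝ) ≤ 0 := by exact_mod_cast hi
      linarith
    · intro hi
      exact_mod_cast v.idx_le_start.trans hi
  have hL : (IsExterior v ∧ v.idx ≤ 0) ↔ (IsStd v.start 0 ∧ v.start ≤ 0) := by
    rw [hE]
    exact and_congr_right h0
  have hN := h.isLeftOfCaret_iff (v := v)
  rw [label, pointLabel]
  split_ifs <;> first | rfl | tauto

end Adapted

open Classical in
/-- The tree of depth at most the given number whose carets are at the paths with a property. -/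
def treeOf : ℕ → (List Bool → Prop) → BinaryTree Unit
  | 0, _ => .nil
  | n + 1, P => if P [] then
      .node () (treeOf n fun p => P (false :: p)) (treeOf n fun p => P (true :: p)) else .nil

theorem isCaretPath_treeOf {n : ℕ} {P : List Bool → Prop} (hn : ∀ p, P p → p.length < n)
    (hP : ∀ p q, P (p ++ q) → P p) (p : List Bool) : IsCaretPath (treeOf n P) p ↔ P p := by
  induction n generalizing P p with
  | zero => exact iff_of_false id fun h => by simpa using hn p h
  | succ n ih =>
    rw [treeOf]
    by_cases h0 : P []
    · rw [if_pos h0]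
      match p with
      | [] => exact iff_of_true trivial h0
      | false :: p =>
        exact ih (fun p hp => by simpa using hn _ hp) (fun p q h => hP (false :: p) q h) p
      | true :: p =>
        exact ih (fun p hp => by simpa using hn _ hp) (fun p q h => hP (true :: p) q h) p
    · rw [if_neg h0]
      exact iff_of_false id fun h => h0 (hP [] p h)

theorem mem_badSet_of_append {f : ℝ ≃o ℝ} {i : ℤ} {p q : List Bool}
    (h : ((i : ℝ) + pathStart (p ++ q), (p ++ q).length) ∈ badSet f) :
    ((i : ℝ) + pathStart p, p.length) ∈ badSet f := by
  refine ⟨isStd_vertex i p, fun b m hc => ?_⟩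
  have happ := vertex_append i p q
  obtain ⟨b', m', h'⟩ := hc.sub h.1 (by simp) happ.1 happ.2
  exact h.2 _ _ h'

/-- Finiteness of `badSet f` bounds the depth of the trees and the number of nontrivial ones;
closure under prefixes (`mem_badSet_of_append`) makes the bad vertices the carets of trees. -/
theorem exists_adapted {f : ℝ ≃o ℝ} (hf : IsPL2 f) : ∃ T : BinaryForest, T.Adapted f := by
  have hfin := hf.finite_badSet
  have hN : ∀ i : ℤ, ∀ p : List Bool, ((i : ℝ) + pathStart p, p.length) ∈ badSet f →
      p.length < hfin.toFinset.sup Prod.snd + 1 := fun i p h =>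
    Nat.lt_succ_of_le (Finset.le_sup (f := Prod.snd) (hfin.mem_toFinset.mpr h))
  have hiff : ∀ (i : ℤ) (p : List Bool), IsCaretPath (treeOf (hfin.toFinset.sup Prod.snd + 1)
      fun p => ((i : ℝ) + pathStart p, p.length) ∈ badSet f) p ↔
      ((i : ℝ) + pathStart p, p.length) ∈ badSet f := fun i p =>
    isCaretPath_treeOf (P := fun p => ((i : ℝ) + pathStart p, p.length) ∈ badSet f) (hN i)
      (fun _ _ h => mem_badSet_of_append h) p
  refine ⟨⟨fun i => treeOf (hfin.toFinset.sup Prod.snd + 1)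
    fun p => ((i : ℝ) + pathStart p, p.length) ∈ badSet f, ?_⟩, hiff⟩
  refine (hfin.preimage (f := fun i : ℤ => ((i : ℝ) + pathStart [], 0)) ?_).subset fun i hi => ?_
  · intro i _ j _ h
    simpa using h
  · exact (hiff i []).mp (isCaretPath_nil_iff.mpr hi)

end BinaryForest

/-! ### Existence and uniqueness of the reduced diagram -/

namespace ForestDiagram

/-- Exchange the two forests of a diagram. -/
def swap (𝔣 : ForestDiagram) : ForestDiagram := ⟨𝔣.top, 𝔣.bot, 𝔣.bij.symm⟩

variable {𝔣 : ForestDiagram} {f : F}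

theorem Represents.corr (h : 𝔣.Represents f) (v : 𝔣.bot.Leaf) :
    Corr (f : ℝ ≃o ℝ) v.start v.path.length (𝔣.bij v).start (𝔣.bij v).path.length :=
  ⟨v.isStd_start, (𝔣.bij v).isStd_start, h v⟩

theorem Represents.swap (h : 𝔣.Represents f) : 𝔣.swap.Represents f⁻¹ := by
  intro (v : 𝔣.top.Leaf) s hs
  have := (h.corr (𝔣.bij.symm v)).symm.map s hs
  rw [OrderIso.apply_symm_apply] at this
  exact this

theorem IsReduced.swap (h : 𝔣.IsReduced) : 𝔣.swap.IsReduced := by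
  rintro ⟨(v : 𝔣.top.Leaf), (w : 𝔣.top.Leaf), i, j, p, q, h1, h2, h3, h4⟩
  refine h ⟨𝔣.bij.symm v, 𝔣.bij.symm w, j, i, q, p, h3, h4, ?_, ?_⟩
  · rw [OrderIso.apply_symm_apply]; exact h1
  · rw [OrderIso.apply_symm_apply]; exact h2

/-- A caret with two leaves as children which is mapped linearly onto a standard dyadic interval
opposes a caret of the top forest. -/
theorem Represents.not_isReduced_of_corr (h : 𝔣.Represents f) {i : ℤ} {p : List Bool} {b : ℝ}
    {m : ℕ} (hc : Corr (f : ℝ ≃o ℝ) (i + pathStart p) p.length b m)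
    (h0 : IsLeafPath (𝔣.bot.tree i) (p ++ [false])) (h1 : IsLeafPath (𝔣.bot.tree i) (p ++ [true])) :
    ¬ 𝔣.IsReduced := by
  obtain ⟨j, q, rfl, rfl⟩ := exists_vertex hc.right
  have key : ∀ (c : Bool) (hl : IsLeafPath (𝔣.bot.tree i) (p ++ [c])),
      (𝔣.bij ⟨(i, p ++ [c]), hl⟩).1 = (j, q ++ [c]) := by
    intro c hl
    have hv := h.corr ⟨(i, p ++ [c]), hl⟩
    have hv' : Corr (f : ℝ ≃o ℝ) ((i : ℝ) + pathStart (p ++ [c])) (p ++ [c]).length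
        ((j : ℝ) + pathStart (q ++ [c])) (q ++ [c]).length := by
      refine ⟨isStd_vertex _ _, isStd_vertex _ _, fun s hs => ?_⟩
      rw [pathStart_append, pathStart_append, List.length_append, List.length_append,
        List.length_singleton, width_succ, width_succ]
      have hs' : pathStart [c] + s / 2 ∈ Set.Icc (0 : ℝ) 1 := by
        cases c <;> simp only [pathStart] <;> constructor <;> linarith [hs.1, hs.2]
      have := hc.map _ hs'
      rw [show (i : ℝ) + (pathStart p + pathStart [c] * (1 / 2) ^ p.length) +
        s * ((1 / 2) ^ p.length / 2) = i + pathStart p +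
        (pathStart [c] + s / 2) * (1 / 2) ^ p.length by ring, this]
      ring
    obtain ⟨h2, h3⟩ := hv.unique hv'
    obtain ⟨h4, h5⟩ := vertex_injective h3 h2
    exact Prod.ext h4 h5
  exact fun hr => hr ⟨_, _, i, j, p, q, rfl, rfl, key false h0, key true h1⟩

/-- If some caret were mapped linearly onto a standard interval, take a deepest one. Its children
inherit linearity, so they are leaves, and an opposing pair appears. Conversely, a vertex that is no
caret lies inside a leaf and is mapped linearly. -/
theorem Represents.adapted (h : 𝔣.Represents f) (hr : 𝔣.IsReduced) :
    𝔣.bot.Adapted (f : ℝ ≃o ℝ) := by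
  intro i p
  constructor
  · intro hp
    refine ⟨isStd_vertex i p, fun b m hc => ?_⟩
    have hfin : {p | IsCaretPath (𝔣.bot.tree i) p ∧
        ∃ b m, Corr (f : ℝ ≃o ℝ) (i + pathStart p) p.length b m}.Finite :=
      (caretFinset (𝔣.bot.tree i)).finite_toSet.subset fun p hp => mem_caretFinset.mpr hp.1
    obtain ⟨q, ⟨hq, b, m, hc⟩, hmax⟩ := Set.exists_max_image _ List.length hfin ⟨p, hp, b, m, hc⟩
    have hleaf : ∀ c, IsLeafPath (𝔣.bot.tree i) (q ++ [c]) := by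
      intro c
      refine (hq.child c).resolve_left fun hcar => ?_
      have happ := vertex_append i q [c]
      have := hmax (q ++ [c]) ⟨hcar, hc.sub (isStd_vertex i (q ++ [c])) (by simp) happ.1 happ.2⟩
      simp at this
    exact h.not_isReduced_of_corr hc (hleaf false) (hleaf true) hr
  · intro hb
    by_contra hp
    obtain ⟨v, r, rfl, rfl⟩ := exists_leaf_of_not_isCaretPath hp
    exact (mem_badSet_of_append hb).2 _ _ (h.corr v)

/-- Opposing carets would glue the linear pieces of their children into one linear piece, so the
bottom caret would not be bad. -/
theorem Represents.isReduced_of_adapted (h : 𝔣.Represents f)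
    (ha : 𝔣.bot.Adapted (f : ℝ ≃o ℝ)) : 𝔣.IsReduced := by
  rintro ⟨v, w, i, j, p, q, h1, h2, h3, h4⟩
  have hv := h.corr v
  have hw := h.corr w
  simp only [Leaf.start, Leaf.idx, Leaf.path, h1, h2, h3, h4, pathStart_append, pathStart,
    List.length_append, List.length_singleton, zero_div, zero_mul, add_zero] at hv hw
  have hcar : IsCaretPath (𝔣.bot.tree i) p := by
    have := v.2
    rw [h1] at this
    exact this.isCaretPath_of_append
  refine ((ha i p).mp hcar).2 (j + pathStart q) q.length
    ⟨isStd_vertex _ _, isStd_vertex _ _, fun s hs => ?_⟩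
  rcases le_total s (1 / 2) with hs2 | hs2
  · have := hv.map (2 * s) ⟨by linarith [hs.1], by linarith⟩
    rw [width_succ, width_succ] at this
    rw [show s * (1 / 2 : ℝ) ^ p.length = 2 * s * ((1 / 2) ^ p.length / 2) by ring, this]
    ring
  · have := hw.map (2 * s - 1) ⟨by linarith, by linarith [hs.2]⟩
    rw [width_succ, width_succ] at this
    rw [show (i : ℝ) + pathStart p + s * (1 / 2 : ℝ) ^ p.length =
      i + (pathStart p + 1 / 2 * (1 / 2) ^ p.length) +
        (2 * s - 1) * ((1 / 2) ^ p.length / 2) by ring, this]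
    ring

theorem Represents.unique {𝔣 𝔤 : ForestDiagram} (h : 𝔣.Represents f) (h' : 𝔤.Represents f)
    (hr : 𝔣.IsReduced) (hr' : 𝔤.IsReduced) : 𝔣 = 𝔤 := by
  have h1 := (h.adapted hr).unique (h'.adapted hr')
  have h2 : 𝔣.top = 𝔤.top := (h.swap.adapted hr.swap).unique (h'.swap.adapted hr'.swap)
  obtain ⟨b, t, e⟩ := 𝔣
  obtain ⟨b', t', e'⟩ := 𝔤
  obtain rfl : b = b' := h1
  obtain rfl : t = t' := h2
  obtain rfl : e = e' := by
    ext v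
    exact Leaf.start_injective ((h.corr v).apply_left.symm.trans (h'.corr v).apply_left)
  rfl

end ForestDiagram

/-- The image of the leaf `v` is not bad for `f⁻¹`, so it lies in a leaf `w` of `T'`. The preimage
of `w` lies in a leaf `u` of `T` and meets `v`, so `u = v` and all inclusions are equalities. -/
theorem BinaryForest.Adapted.exists_leaf {f : ℝ ≃o ℝ} {T T' : BinaryForest} (h : T.Adapted f)
    (h' : T'.Adapted f⁻¹) (v : T.Leaf) :
    ∃ w : T'.Leaf, Corr f v.start v.path.length w.start w.path.length := by
  obtain ⟨b, m, hc⟩ := h.exists_corr v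
  obtain ⟨j, q, rfl, rfl⟩ := exists_vertex hc.right
  have hnc : ¬ IsCaretPath (T'.tree j) q := fun hq => hc.symm.notMem_badSet ((h' j q).mp hq)
  obtain ⟨w, r, rfl, rfl⟩ := exists_leaf_of_not_isCaretPath hnc
  obtain ⟨a, n, hw⟩ := h'.exists_corr w
  rw [corr_inv_iff] at hw
  obtain ⟨i, p, rfl, rfl⟩ := exists_vertex hw.left
  have hnc' : ¬ IsCaretPath (T.tree i) p := fun hp => hw.notMem_badSet ((h i p).mp hp)
  obtain ⟨u, s, rfl, rfl⟩ := exists_leaf_of_not_isCaretPath hnc'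
  have happ := vertex_append w.idx w.path r
  have happ' := vertex_append u.idx u.path s
  have h1 : (u.idx : ℝ) + pathStart (u.path ++ s) ≤ v.start := by
    rw [← f.le_iff_le, hw.apply_left, hc.apply_left]
    exact happ.1
  have h2 : v.start < u.idx + pathStart (u.path ++ s) + (1 / 2) ^ (u.path ++ s).length := by
    rw [← f.lt_iff_lt, hw.apply_right, hc.apply_left]
    exact happ.2
  have h3 := hw.left.add_le_of_lt ((u.isStd_start.add (isStd_width _)).mono (by simp)) happ'.2
  obtain rfl : u = v := Leaf.eq_of_mem (x := v.start) (happ'.1.trans h1) (h2.trans_le h3) le_rfl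
    (by linarith [v.width_pos])
  have h4 : (u.idx : ℝ) + pathStart (u.path ++ s) = u.start := le_antisymm h1 happ'.1
  have h5 : (w.idx : ℝ) + pathStart (w.path ++ r) = w.start := by
    rw [← hc.apply_left, ← h4, hw.apply_left]
  have h6 := f.monotone h3
  have h7 : f (u.start + (1 / 2) ^ u.path.length) = _ := hc.apply_right
  rw [hw.apply_right, h7, h5] at h6
  have h8 := le_of_width_le (by linarith : (1 / 2 : ℝ) ^ w.path.length ≤
    (1 / 2) ^ (w.path ++ r).length)
  have h9 : r = [] := by
    rw [List.length_append] at h8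
    exact List.length_eq_zero_iff.mp (by omega)
  subst h9
  rw [List.append_nil] at hc
  exact ⟨w, hc⟩

namespace ForestDiagram

theorem exists_isReduced_represents (f : F) : ∃ 𝔣 : ForestDiagram, 𝔣.IsReduced ∧ 𝔣.Represents f := by
  obtain ⟨T, hT⟩ := exists_adapted f.2
  obtain ⟨T', hT'⟩ := exists_adapted (IsPL2.inv f.2)
  have hT'' : T.Adapted (f : ℝ ≃o ℝ)⁻¹⁻¹ := by rwa [inv_inv]
  choose φ hφ using hT.exists_leaf hT'
  choose ψ hψ using hT'.exists_leaf hT''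
  simp only [corr_inv_iff] at hψ
  let e : T.Leaf ≃ T'.Leaf := ⟨φ, ψ,
    fun v => Leaf.start_injective ((f : ℝ ≃o ℝ).injective
      ((hψ (φ v)).apply_left.trans (hφ v).apply_left.symm)),
    fun w => Leaf.start_injective ((hφ (ψ w)).apply_left.symm.trans (hψ w).apply_left)⟩
  let 𝔣 : ForestDiagram := ⟨T, T', ⟨e, fun {u v} => by
    change (φ u).start ≤ (φ v).start ↔ u.start ≤ v.start
    rw [← (hφ u).apply_left, ← (hφ v).apply_left, (f : ℝ ≃o ℝ).le_iff_le]⟩⟩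
  have hrep : 𝔣.Represents f := fun v => (hφ v).map
  exact ⟨𝔣, hrep.isReduced_of_adapted hT, hrep⟩

/-! ### The length of a diagram -/

variable {𝔣 : ForestDiagram} {f : F}

theorem mem_supportSpaces_iff {v : 𝔣.bot.Leaf} :
    v ∈ 𝔣.supportSpaces ↔ (∃ a, 𝔣.IsEssential a ∧ a < v) ∧ ∃ b, 𝔣.IsEssential b ∧ v ≤ b := by
  constructor
  · rintro ⟨⟨a, b, ha, hb, hav, hvb⟩, u, ⟨a', b', ha', hb', hau, hub⟩, huv⟩
    exact ⟨⟨a', ha', hau.trans_lt huv⟩, b, hb, hvb⟩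
  · rintro ⟨⟨a, ha, hav⟩, b, hb, hvb⟩
    exact ⟨⟨a, b, ha, hb, hav.le, hvb⟩, a, ⟨a, b, ha, hb, le_rfl, hav.le.trans hvb⟩, hav⟩

end ForestDiagram

/-! ### Trivial parts of forests -/

theorem LeftTrivial.inv {f : ℝ ≃o ℝ} {t : ℝ} (h : LeftTrivial f t) : LeftTrivial f⁻¹ (f t) := by
  refine ⟨h.isStd_apply, by simpa using h.isStd, h.apply_nonpos, by simpa using h.nonpos,
    fun s hs => f.injective ?_⟩
  simp only [RelIso.apply_inv_self, RelIso.inv_apply_self]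
  rw [h.apply_eq _ (by linarith)]
  ring

theorem RightTrivial.inv {f : ℝ ≃o ℝ} {t : ℝ} (h : RightTrivial f t) : RightTrivial f⁻¹ (f t) := by
  refine ⟨h.isStd_apply, by simpa using h.isStd, h.apply_pos, by simpa using h.pos,
    fun s hs => f.injective ?_⟩
  simp only [RelIso.apply_inv_self, RelIso.inv_apply_self]
  rw [h.apply_eq _ (by linarith)]
  ring

theorem apply_eq_of_unit_steps_left {f : ℝ ≃o ℝ} {t : ℝ} (ht : IsStd t 0)
    (h : ∀ x, IsStd x 0 → x < t → ∀ s ∈ Set.Icc (0 : ℝ) 1, f (x + s) = f x + s) :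
    ∀ s ≤ t, f s = s + (f t - t) := by
  have key : ∀ n : ℕ, ∀ s, t - n ≤ s → s ≤ t → f s = s + (f t - t) := by
    intro n
    induction n with
    | zero =>
      intro s h1 h2
      rw [Nat.cast_zero, sub_zero] at h1
      rw [le_antisymm h2 h1]
      ring
    | succ n ih =>
      intro s h1 h2
      push_cast at h1
      rcases le_or_gt (t - n) s with h3 | h3
      · exact ih s h3 h2
      have hn : (0 : ℝ) ≤ n := n.cast_nonneg
      have hx := h (t - (n + 1)) (ht.sub (by exact_mod_cast isStd_intCast (n + 1) 0)) (by linarith)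
      have h4 := hx 1 (by simp)
      have h5 := hx (s - (t - (n + 1))) ⟨by linarith, by linarith⟩
      rw [add_sub_cancel] at h5
      rw [show t - ((n : ℝ) + 1) + 1 = t - n by ring, ih (t - n) le_rfl (by linarith)] at h4
      rw [h5]
      linarith
  intro s hs
  obtain ⟨n, hn⟩ := exists_nat_ge (t - s)
  exact key n s (by linarith) hs

theorem apply_eq_of_unit_steps_right {f : ℝ ≃o ℝ} {t : ℝ} (ht : IsStd t 0)
    (h : ∀ x, IsStd x 0 → t ≤ x → ∀ s ∈ Set.Icc (0 : ℝ) 1, f (x + s) = f x + s) :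
    ∀ s ≥ t, f s = s + (f t - t) := by
  have key : ∀ n : ℕ, ∀ s, s ≤ t + n → t ≤ s → f s = s + (f t - t) := by
    intro n
    induction n with
    | zero =>
      intro s h1 h2
      rw [Nat.cast_zero, add_zero] at h1
      rw [le_antisymm h1 h2]
      ring
    | succ n ih =>
      intro s h1 h2
      push_cast at h1
      rcases le_or_gt s (t + n) with h3 | h3
      · exact ih s h3 h2
      have hn : (0 : ℝ) ≤ n := n.cast_nonneg
      have h5 := h (t + n) (ht.add (by exact_mod_cast isStd_intCast n 0)) (by linarith)
        (s - (t + n)) ⟨by linarith, by linarith⟩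
      rw [add_sub_cancel, ih (t + n) le_rfl (by linarith)] at h5
      rw [h5]
      ring
  intro s hs
  obtain ⟨n, hn⟩ := exists_nat_ge (s - t)
  exact key n s (by linarith) hs

namespace BinaryForest

variable {T : BinaryForest} {f : ℝ ≃o ℝ} {t : ℝ}

theorem Leaf.path_eq_nil {v : T.Leaf} (h : T.tree v.idx = .nil) : v.path = [] := by
  have := v.2
  change IsLeafPath (T.tree v.idx) v.path at this
  rw [h] at this
  revert this
  cases v.path with
  | nil => exact fun _ => rfl
  | cons => exact False.elim

theorem Leaf.isStd_start_zero {v : T.Leaf} (h : T.tree v.idx = .nil) : IsStd v.start 0 := by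
  have := v.isStd_start
  rwa [path_eq_nil h] at this

theorem exists_leaf_idx_zero (T : BinaryForest) : ∃ v : T.Leaf, v.idx = 0 ∧ v.start = 0 := by
  obtain ⟨v, h1, h2⟩ := T.exists_leaf_mem 0
  have h0 : v.idx = 0 := idx_eq_of_vertex_mem (x := 0) (v.idx_le_start.trans h1)
    (h2.trans_le v.end_le_idx_add_one) (by simp) (by simp)
  refine ⟨v, h0, le_antisymm h1 ?_⟩
  have := v.idx_le_start
  rwa [h0, Int.cast_zero] at this

theorem start_left_of_trivial {v : T.Leaf}
    (h : ∀ u < v, u.idx ≠ 0 ∧ T.tree u.idx = .nil) : IsStd v.start 0 ∧ v.start ≤ 0 := by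
  constructor
  · by_contra hs
    obtain ⟨u, hlt, hu⟩ := isInterior_iff.mpr hs
    exact hs (Leaf.isStd_start_zero (hu ▸ (h u hlt).2))
  · by_contra! hc
    obtain ⟨u, h0, hu⟩ := T.exists_leaf_idx_zero
    exact (h u (Leaf.lt_iff.mpr (hu ▸ hc))).1 h0

theorem start_right_of_trivial {v : T.Leaf}
    (h : ∀ u ≥ v, u.idx ≠ 0 ∧ T.tree u.idx = .nil) : IsStd v.start 0 ∧ 0 < v.start := by
  refine ⟨Leaf.isStd_start_zero (h v le_rfl).2, ?_⟩
  by_contra! hc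
  obtain ⟨u, h0, hu⟩ := T.exists_leaf_idx_zero
  exact (h u (Leaf.le_iff.mpr (hu ▸ hc))).1 h0

theorem Adapted.trivial_of_leftTrivial (h : T.Adapted f) (ht : LeftTrivial f t) {u : T.Leaf}
    (hu : u.start < t) : u.idx ≠ 0 ∧ T.tree u.idx = .nil := by
  have h1 := u.idx_le_start
  constructor
  · intro h0
    rw [h0, Int.cast_zero] at h1
    linarith [ht.nonpos]
  · by_contra hc
    have hb := (h u.idx []).mp (isCaretPath_nil_iff.mpr hc)
    have hint : IsStd (u.idx : ℝ) 0 := isStd_intCast _ _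
    have h2 := hint.add_le_of_lt ht.isStd (h1.trans_lt hu)
    simp only [pathStart, add_zero, List.length_nil] at hb
    refine hb.2 (u.idx + (f t - t)) 0
      ⟨hint, hint.add (ht.isStd_apply.sub ht.isStd), fun s hs => ?_⟩
    rw [pow_zero] at h2 ⊢
    rw [ht.apply_eq _ (by linarith [hs.2])]
    ring

theorem Adapted.trivial_of_rightTrivial (h : T.Adapted f) (ht : RightTrivial f t) {u : T.Leaf}
    (hu : t ≤ u.start) : u.idx ≠ 0 ∧ T.tree u.idx = .nil := by
  have h1 := u.start_lt_idx_add_one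
  have hint : IsStd (u.idx : ℝ) 0 := isStd_intCast _ _
  have h2 : t ≤ u.idx := by
    by_contra! hc
    have := hint.add_le_of_lt ht.isStd hc
    rw [pow_zero] at this
    linarith
  constructor
  · intro h0
    rw [h0, Int.cast_zero] at h2
    linarith [ht.pos]
  · by_contra hc
    have hb := (h u.idx []).mp (isCaretPath_nil_iff.mpr hc)
    simp only [pathStart, add_zero, List.length_nil] at hb
    refine hb.2 (u.idx + (f t - t)) 0
      ⟨hint, hint.add (ht.isStd_apply.sub ht.isStd), fun s hs => ?_⟩
    rw [pow_zero, ht.apply_eq _ (by linarith [hs.1])]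
    ring

end BinaryForest

namespace ForestDiagram

variable {𝔣 : ForestDiagram} {f : F}

theorem not_isEssential_iff {u : 𝔣.bot.Leaf} : ¬ 𝔣.IsEssential u ↔
    (u.idx ≠ 0 ∧ 𝔣.bot.tree u.idx = .nil) ∧
      ((𝔣.bij u).idx ≠ 0 ∧ 𝔣.top.tree (𝔣.bij u).idx = .nil) := by
  unfold IsEssential
  tauto

theorem Represents.apply_add_of_trivial (h : 𝔣.Represents f) {x : ℝ} (hx : IsStd x 0)
    {u : 𝔣.bot.Leaf} (hu : u.start ≤ x) (hu' : x < u.start + u.width) (he : ¬ 𝔣.IsEssential u) :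
    ∀ s ∈ Set.Icc (0 : ℝ) 1, (f : ℝ ≃o ℝ) (x + s) = (f : ℝ ≃o ℝ) x + s := by
  obtain ⟨⟨-, h1⟩, -, h2⟩ := not_isEssential_iff.mp he
  have hc := h.corr u
  rw [Leaf.width, Leaf.path_eq_nil h1] at hu'
  rw [Leaf.path_eq_nil h1, Leaf.path_eq_nil h2] at hc
  have hux : u.start = x := (Leaf.isStd_start_zero h1).eq_of_mem hx hu hu' le_rfl (by simp)
  intro s hs
  have := hc.map s hs
  rw [hux] at hc this
  rw [hc.apply_left]
  simpa using this

/-- When no column to the left of `v` is essential, those columns match trivial trees on the far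
side of both pointers, and the unit steps add up to a translation. -/
theorem Represents.leftTrivial_iff (h : 𝔣.Represents f) (hr : 𝔣.IsReduced) {v : 𝔣.bot.Leaf} :
    LeftTrivial (f : ℝ ≃o ℝ) v.start ↔ ¬ ∃ a, 𝔣.IsEssential a ∧ a < v := by
  have hfv : (f : ℝ ≃o ℝ) v.start = (𝔣.bij v).start := (h.corr v).apply_left
  constructor
  · rintro ht ⟨a, ha, hav⟩
    refine not_isEssential_iff.mpr ⟨(h.adapted hr).trivial_of_leftTrivial ht hav, ?_⟩ ha
    refine (h.swap.adapted hr.swap).trivial_of_leftTrivial ht.inv ?_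
    rw [hfv]
    exact Leaf.lt_iff.mp (𝔣.bij.lt_iff_lt.mpr hav)
  · intro hne
    have hE : ∀ u < v, ¬ 𝔣.IsEssential u := fun u hu hu' => hne ⟨u, hu', hu⟩
    obtain ⟨h1, h2⟩ := start_left_of_trivial fun u hu => (not_isEssential_iff.mp (hE u hu)).1
    obtain ⟨h3, h4⟩ := start_left_of_trivial (v := 𝔣.bij v) fun u hu => by
      have := (not_isEssential_iff.mp (hE (𝔣.bij.symm u) (𝔣.bij.symm_apply_lt.mpr hu))).2
      rwa [OrderIso.apply_symm_apply] at this
    refine ⟨h1, hfv ▸ h3, h2, hfv ▸ h4, apply_eq_of_unit_steps_left h1 fun x hx hxv => ?_⟩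
    obtain ⟨u, hu, hu'⟩ := 𝔣.bot.exists_leaf_mem x
    exact h.apply_add_of_trivial hx hu hu' (hE u (Leaf.lt_iff.mpr (hu.trans_lt hxv)))

/-- The column `v` is included here, unlike on the left, because the space meant is the one to the
left of `v`. -/
theorem Represents.rightTrivial_iff (h : 𝔣.Represents f) (hr : 𝔣.IsReduced) {v : 𝔣.bot.Leaf} :
    RightTrivial (f : ℝ ≃o ℝ) v.start ↔ ¬ ∃ b, 𝔣.IsEssential b ∧ v ≤ b := by
  have hfv : (f : ℝ ≃o ℝ) v.start = (𝔣.bij v).start := (h.corr v).apply_left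
  constructor
  · rintro ht ⟨b, hb, hvb⟩
    refine not_isEssential_iff.mpr ⟨(h.adapted hr).trivial_of_rightTrivial ht hvb, ?_⟩ hb
    refine (h.swap.adapted hr.swap).trivial_of_rightTrivial ht.inv ?_
    rw [hfv]
    exact Leaf.le_iff.mp (𝔣.bij.le_iff_le.mpr hvb)
  · intro hne
    have hE : ∀ u ≥ v, ¬ 𝔣.IsEssential u := fun u hu hu' => hne ⟨u, hu', hu⟩
    obtain ⟨h1, h2⟩ := start_right_of_trivial fun u hu => (not_isEssential_iff.mp (hE u hu)).1
    obtain ⟨h3, h4⟩ := start_right_of_trivial (v := 𝔣.bij v) fun u hu => by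
      have := (not_isEssential_iff.mp (hE (𝔣.bij.symm u) (𝔣.bij.le_symm_apply.mpr hu))).2
      rwa [OrderIso.apply_symm_apply] at this
    refine ⟨h1, hfv ▸ h3, h2, hfv ▸ h4, apply_eq_of_unit_steps_right h1 fun x hx hxv => ?_⟩
    obtain ⟨u, hu, hu'⟩ := 𝔣.bot.exists_leaf_mem x
    have hxu : u.start = x := by
      by_contra hc
      have hlt := lt_of_le_of_ne hu hc
      have h5 := u.isStd_start.add_le_of_lt (hx.mono (Nat.zero_le _)) hlt
      rw [Leaf.width] at hu'
      linarith
    exact h.apply_add_of_trivial hx hu hu' (hE u (Leaf.le_iff.mpr (hxu ▸ hxv)))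

theorem Represents.mem_supportSpaces_iff (h : 𝔣.Represents f) (hr : 𝔣.IsReduced)
    {v : 𝔣.bot.Leaf} : v ∈ 𝔣.supportSpaces ↔
      ¬ (LeftTrivial (f : ℝ ≃o ℝ) v.start ∨ RightTrivial (f : ℝ ≃o ℝ) v.start) := by
  rw [ForestDiagram.mem_supportSpaces_iff, h.leftTrivial_iff hr, h.rightTrivial_iff hr,
    not_or, not_not, not_not]

end ForestDiagram

theorem Corr.pointLabel_eq_I {f : ℝ ≃o ℝ} {a b t : ℝ} {n m : ℕ} (h : Corr f a n b m) (h1 : a < t)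
    (h2 : t < a + (1 / 2) ^ n) : pointLabel f t = .I := by
  have hk : ∀ k, IsStd t k → n ≤ k := by
    intro k hk
    by_contra! hc
    linarith [h.left.add_le_of_lt (hk.mono hc.le) h1]
  refine Thompson.pointLabel_eq_I (fun h0 => ?_) ?_
  · linarith [h.left.add_le_of_lt (h0.mono (Nat.zero_le n)) h1]
  · rintro ⟨k, hb⟩
    obtain ⟨b', m', h'⟩ := h.sub hb.1 (hk k hb.1) h1.le h2
    exact hb.2 _ _ h'

/-! ### The weight of a diagram as a sum over the line -/

namespace ForestDiagram

variable {𝔣 : ForestDiagram} {f : F}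

/-- A point in the interior of a leaf interval has labels (I, I), hence weight `0`. -/
theorem Represents.support_pointWeight_subset (h : 𝔣.Represents f) :
    Function.support (pointWeight (f : ℝ ≃o ℝ)) ⊆ Set.range (Leaf.start (T := 𝔣.bot)) := by
  intro t ht
  obtain ⟨v, hv, hv'⟩ := 𝔣.bot.exists_leaf_mem t
  refine ⟨v, hv.eq_or_lt.resolve_right fun hlt => ht ?_⟩
  have hc := h.corr v
  rw [Leaf.width] at hv'
  refine Nat.le_zero.mp ((pointWeight_le _ _).trans_eq ?_)
  rw [hc.pointLabel_eq_I hlt hv', hc.symm.pointLabel_eq_I ?_ ?_]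
  · rfl
  · rw [← hc.apply_left]
    exact (f : ℝ ≃o ℝ).strictMono hlt
  · rw [← hc.apply_right]
    exact (f : ℝ ≃o ℝ).strictMono hv'

theorem Represents.ell0_eq (h : 𝔣.Represents f) (hr : 𝔣.IsReduced) :
    𝔣.ell0 = ∑ᶠ t, pointWeight (f : ℝ ≃o ℝ) t := by
  have h1 : 𝔣.ell0 = ∑ᶠ v : 𝔣.bot.Leaf, pointWeight (f : ℝ ≃o ℝ) v.start := by
    refine finsum_congr fun v => ?_
    have hlab : label (𝔣.bij v) = pointLabel (f : ℝ ≃o ℝ)⁻¹ ((f : ℝ ≃o ℝ) v.start) := by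
      rw [(h.corr v).apply_left]
      exact (h.swap.adapted hr.swap).label_eq (𝔣.bij v)
    classical
    rw [pointWeight, hlab, (h.adapted hr).label_eq v]
    by_cases hv : v ∈ 𝔣.supportSpaces
    · rw [finsum_eq_if, if_pos hv, if_neg ((h.mem_supportSpaces_iff hr).mp hv)]
    · rw [finsum_eq_if, if_neg hv, if_pos (not_not.mp fun h' =>
        hv ((h.mem_supportSpaces_iff hr).mpr h'))]
  rw [h1, ← finsum_mem_range Leaf.start_injective, ← finsum_mem_univ (pointWeight _)]
  refine finsum_mem_inter_support_eq _ _ _ ?_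
  rw [Set.univ_inter, Set.inter_eq_right.mpr h.support_pointWeight_subset]

theorem Represents.ell0_add_ell1 (h : 𝔣.Represents f) (hr : 𝔣.IsReduced) :
    𝔣.ell0 + 𝔣.ell1 = mapLength (f : ℝ ≃o ℝ) := by
  have h1 := (h.adapted hr).numCarets
  have h2 : 𝔣.top.numCarets = (badSet (f : ℝ ≃o ℝ)⁻¹).ncard := (h.swap.adapted hr.swap).numCarets
  rw [h.ell0_eq hr, ell1, mapLength, h1, h2, add_comm]

end ForestDiagram

end Thompson

end

theorem theorem4p2p2 (f : Thompson.F) :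
    (∃! 𝔣 : Thompson.ForestDiagram, 𝔣.IsReduced ∧ 𝔣.Represents f) ∧
    ∀ 𝔣 : Thompson.ForestDiagram, 𝔣.IsReduced → 𝔣.Represents f →
      IsLeast (Thompson.wordLengths {Thompson.x0, Thompson.x1} f) (𝔣.ell0 + 𝔣.ell1) := by
  refine ⟨?_, fun 𝔣 hr h => ?_⟩
  · obtain ⟨𝔣, hr, h⟩ := Thompson.ForestDiagram.exists_isReduced_represents f
    exact ⟨𝔣, ⟨hr, h⟩, fun 𝔤 ⟨hr', h'⟩ => h'.unique h hr' hr⟩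
  · rw [h.ell0_add_ell1 hr]
    exact Thompson.isLeast_wordLengths f
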